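/- Let $G$ be a group, let $n\ge 0$, and let $\delta(x,\bar y)$ be a relation on $G\times G^{n}$ which is (left) invariant, i.e. for all $\bar b\in G^{n}$ and $a\in G$ there is $\bar c\in G^{n}$ such that $\delta(ax,\bar b)\Leftrightarrow\delta(x,\bar c)$ for all $x\in G$, and stable, i.e. for some $k\ge 1$ there are no $a_1,\dots,a_k\in G$ and $\bar b_1,\dots,\bar b_k\in G^{n}$ such that $\delta(a_i,\bar b_j)$ holds if and only if $i\le j$. Let $\operatorname{Def}_\delta(G)$ be the Boolean algebra of subsets of $G$ generated by the sets $\{x\in G:\delta(x,\bar b)\}$, $\bar b\in G^{n}$ (it contains $\emptyset$ and $G$). A set $A\subseteq G$ is generic if finitely many left translates of $A$ cover $G$. A complete $\delta$-type is a maximal subset $p$ of $\operatorname{Def}_\delta(G)$ such that any finitely many members of $p$ have a common element in $G$; it is generic if all its members are generic. A $\delta$-Keisler measure is a finitely additive probability measure on $\operatorname{Def}_\delta(G)$. Let $M_\delta$ be the first-order structure expanding the group $G$ by the relation $\delta$. There is a unique equivalence relation $E_\delta$ on $G$ such that: $E_\delta$ is definable without parameters in $M_\delta$; it has finitely many classes,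 all in $\operatorname{Def}_\delta(G)$; it is $G$-invariant, i.e. $E_\delta(a,b)\Leftrightarrow E_\delta(ga,gb)$ for all $a,b,g\in G$; and two generic complete $\delta$-types are equal if and only if they contain the same $E_\delta$-class. Let $G^0_\delta$ be the $E_\delta$-class of the identity. Then: (i) $G^0_\delta$ is a subgroup of $G$ of finite index and belongs to $\operatorname{Def}_\delta(G)$, and the $E_\delta$-classes are precisely the left cosets of $G^0_\delta$. (ii) Each left coset of $G^0_\delta$ is a member of exactly one generic complete $\delta$-type. (iii) For every $\phi\in\operatorname{Def}_\delta(G)$ and every left coset $C$ of $G^0_\delta$, exactly one of $C\cap\phi$ and $C\setminus\phi$ is generic. (iv) For every $\phi\in\operatorname{Def}_\delta(G)$, if $Y$ is the union of those left cosets $C$ of $G^0_\delta$ for which $C\cap\phi$ is generic, then the symmetric difference $\phi\,\triangle\, Y$ is not generic. (v) $G^0_\delta$ is the smallest finite-index subgroup of $G$ that belongs to $\operatorname{Def}_\delta(G)$, i.e. it is contained in every other such subgroup. (vi) There is a unique left-invariant $\delta$-Keisler measure $\mu_\delta$ on $\operatorname{Def}_\delta(G)$, and for $\phi\in\operatorname{Def}_\delta(G)$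 we have $\mu_\delta(\phi)>0$ if and only if $\phi$ is generic. -/

import Mathlib

open scoped Pointwise

namespace LocalStable

/-- Function symbols of the language of groups. -/
inductive GroupFunc : ℕ → Type
  | one : GroupFunc 0
  | inv : GroupFunc 1
  | mul : GroupFunc 2

/-- One relation symbol `δ(x, y₁, …, yₙ)`, of arity `n + 1`. -/
inductive DeltaRel (n : ℕ) : ℕ → Type
  | delta : DeltaRel n (n + 1)

/-- The language of groups together with a relation symbol for `δ(x, ȳ)`, `|ȳ| = n`. -/
def deltaLanguage (n : ℕ) : FirstOrder.Language where
  Functions := GroupFunc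
  Relations := DeltaRel n

section

variable {G : Type*} [Group G] {n : ℕ} (δ : G → (Fin n → G) → Prop)

/-- The structure `M_δ`: the group `G` expanded by the relation `δ`. -/
@[reducible]
def deltaStructure : (deltaLanguage n).Structure G where
  funMap := fun f v => match f, v with
    | GroupFunc.one, _ => 1
    | GroupFunc.inv, v => (v 0)⁻¹
    | GroupFunc.mul, v => v 0 * v 1
  RelMap := fun r v => match r, v with
    | DeltaRel.delta, v => δ (v 0) (fun i => v i.succ)

/-- Left invariance of `δ(x, ȳ)`. -/
def IsLeftInvariantRel : Prop :=
  ∀ (b : Fin n → G) (a : G), ∃ c : Fin n → G, ∀ x : G, δ (a * x) b ↔ δ x c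

/-- `δ(x, ȳ)` is `k`-stable. -/
def IsKStable (k : ℕ) : Prop :=
  ¬ ∃ (a : Fin k → G) (b : Fin k → Fin n → G), ∀ i j, δ (a i) (b j) ↔ i ≤ j

/-- `δ(x, ȳ)` is stable. -/
def IsStable : Prop := ∃ k : ℕ, 1 ≤ k ∧ IsKStable δ k

/-- `Def_δ(G)`: the Boolean algebra of subsets of `G` that are finite Boolean combinations of
instances `δ(x, b̄)` (the empty set and `G` included). -/
def DefAlg : BooleanSubalgebra (Set G) :=
  BooleanSubalgebra.closure (Set.range fun b : Fin n → G => {x : G | δ x b})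

/-- A set is (left) generic if finitely many left translates of it cover `G`. -/
def IsGeneric (A : Set G) : Prop :=
  ∃ F : Finset G, (⋃ g ∈ F, g • A) = Set.univ

/-- Complete `δ`-types over `G`, as maximal finitely satisfiable sets of `δ`-definable sets. -/
def IsCompleteType (p : Set (Set G)) : Prop :=
  Maximal (fun q : Set (Set G) => q ⊆ (DefAlg δ : Set (Set G)) ∧
    ∀ F : Finset (Set G), (F : Set (Set G)) ⊆ q → (⋂₀ (F : Set (Set G))).Nonempty) p

/-- Generic complete `δ`-types. -/
def IsGenericType (p : Set (Set G)) : Prop :=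
  IsCompleteType δ p ∧ ∀ A ∈ p, IsGeneric A

/-- A binary relation on `G` is definable without parameters in the structure `M_δ`. -/
def IsEmptyDefinable (R : Set (G × G)) : Prop :=
  letI := deltaStructure δ
  (∅ : Set G).Definable₂ (deltaLanguage n) R

/-- `FER_δ`: the equivalence relations on `G` that are definable without parameters in `M_δ`, have
finitely many classes, and all of whose classes are `δ`-definable. -/
def IsFER (E : Setoid G) : Prop :=
  IsEmptyDefinable δ {z : G × G | E z.1 z.2} ∧
  E.classes.Finite ∧ ∀ C ∈ E.classes, C ∈ DefAlg δ

/-- The defining properties of the relation `E_δ`: it lies in `FER_δ`, it is `G`-invariant, and two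
generic `δ`-types are equal if and only if they contain the same class of it. -/
def IsEDelta (E : Setoid G) : Prop :=
  IsFER δ E ∧
  (∀ a b g : G, E a b ↔ E (g * a) (g * b)) ∧
  ∀ p q : Set (Set G), IsGenericType δ p → IsGenericType δ q →
    (p = q ↔ ∃ C ∈ E.classes, C ∈ p ∧ C ∈ q)

/-- A `δ`-Keisler measure: a finitely additive probability measure on `Def_δ(G)`. -/
def IsKeislerMeasure (μ : DefAlg δ → ℝ) : Prop :=
  (∀ A, 0 ≤ μ A) ∧ μ ⊤ = 1 ∧
  ∀ A B : DefAlg δ, Disjoint (A : Set G) (B : Set G) → μ (A ⊔ B) = μ A + μ B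

/-- Left invariance of a function on `Def_δ(G)`. -/
def IsLeftInvariantMeasure (μ : DefAlg δ → ℝ) : Prop :=
  ∀ (g : G) (A B : DefAlg δ), (B : Set G) = g • (A : Set G) → μ B = μ A

end

/-- The class of the identity; for `E = E_δ` this is the `δ`-connected component `G⁰_δ`. -/
def identityClass {G : Type*} [Group G] (E : Setoid G) : Set G := {x : G | E x 1}

end LocalStable

namespace LocalStable

open Filter

/-! Stability is used only through the double limit property: limits of the relation along two
ultrafilters commute. The property passes to Boolean combinations and, by invariance, to `g * x ∈ φ`
for `φ` in `DefAlg δ`. It has two general consequences. Ultrafilter limits of instances are Boolean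
combinations of instances (`DoubleLimit.limit_mem_closure`). There is also no binary tree of
instances, since its continuum many branches would give distinct members of a countable algebra; so,
for any notion of largeness, some large set is split by no instance
(`DoubleLimit.exists_indivisible`).

With largeness measured by a minimal invariant filter, this yields a type with finite orbit
(`DoubleLimit.exists_finite_orbit`). Applied to `δ`, it gives an ultrafilter `V` whose trace is
fixed by a normal subgroup `N` of finite index. Applied to `g⁻¹ * x ∈ φ` with `g` as variable, it
gives `U`, and the limit of the translates of `φ` along `U` is a definable set invariant under a
finite index subgroup. Exchanging `U` and `V` shows that a translate of this limit agrees with `φ`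
along every translate of `V`, and that definable members of `V` are generic
(`IsStabilizedBy.exists_invariant`). Hence a definable set is generic exactly when some translate of
it lies in `V`, and nongeneric definable sets form an ideal.

Every finite index subgroup in `DefAlg δ` contains `N`, so there are finitely many; their
intersection `H` is the component. The right stabilizer of an invariant definable set is again
definable of finite index, so such a set is a union of left cosets of `H`. Thus each definable set
is a union of cosets up to a nongeneric set, which determines the generic types. An invariant
measure vanishes on nongeneric definable sets (`IsInvariantMeasure.isGeneric_of_pos`), so it must
count cosets. -/

/-- The double limit property: limits of `R` along two ultrafilters can be exchanged. -/
def DoubleLimit {X Y : Type*} (R : X → Y → Prop) : Prop :=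
  ∀ (U : Ultrafilter X) (V : Ultrafilter Y),
    (∀ᶠ x in (U : Filter X), ∀ᶠ y in (V : Filter Y), R x y) ↔
      ∀ᶠ y in (V : Filter Y), ∀ᶠ x in (U : Filter X), R x y

/-! ### Stability as exchange of ultrafilter limits -/

section DoubleLimit

variable {X Y : Type*} {R : X → Y → Prop}

/-- Pairs are chosen recursively: each new point satisfies the conditions that the earlier ones
impose on almost every point, and there are finitely many of these. -/
theorem exists_half_graph {U : Ultrafilter X} {V : Ultrafilter Y}
    (h₁ : ∀ᶠ x in (U : Filter X), ∀ᶠ y in (V : Filter Y), R x y)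
    (h₂ : ∀ᶠ y in (V : Filter Y), ∀ᶠ x in (U : Filter X), ¬ R x y) :
    ∃ (a : ℕ → X) (b : ℕ → Y), ∀ i j, R (a i) (b j) ↔ i ≤ j := by
  obtain ⟨f, hf, hlt⟩ := exists_seq_of_forall_finset_exists
    (fun z : X × Y => (∀ᶠ y in (V : Filter Y), R z.1 y) ∧
      (∀ᶠ x in (U : Filter X), ¬ R x z.2) ∧ R z.1 z.2)
    (fun z w => R z.1 w.2 ∧ ¬ R w.1 z.2) (by
      intro s hs
      have hx : ∀ᶠ x in (U : Filter X), ∀ z ∈ s, ¬ R x z.2 :=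
        (s.eventually_all).2 fun z hz => (hs z hz).2.1
      obtain ⟨x, hx₁, hx₂⟩ := (h₁.and hx).exists
      have hy : ∀ᶠ y in (V : Filter Y), ∀ z ∈ s, R z.1 y :=
        (s.eventually_all).2 fun z hz => (hs z hz).1
      obtain ⟨y, ⟨hy₁, hy₂⟩, hy₃⟩ := ((hx₁.and h₂).and hy).exists
      exact ⟨(x, y), ⟨hx₁, hy₂, hy₁⟩, fun z hz => ⟨hy₃ z hz, hx₂ z hz⟩⟩)
  refine ⟨fun i => (f i).1, fun j => (f j).2, fun i j => ?_⟩
  rcases lt_trichotomy i j with h | rfl | h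
  · exact iff_of_true (hlt i j h).1 h.le
  · exact iff_of_true (hf i).2.2 le_rfl
  · exact iff_of_false (hlt j i h).2 (not_le.2 h)

theorem DoubleLimit.of_no_half_graph (k : ℕ)
    (h : ¬ ∃ (a : Fin k → X) (b : Fin k → Y), ∀ i j, R (a i) (b j) ↔ i ≤ j) :
    DoubleLimit R := by
  intro U V
  refine ⟨fun h₁ => ?_, fun h₁ => ?_⟩
  · by_contra h₂
    rw [← Ultrafilter.eventually_not] at h₂
    simp only [← Ultrafilter.eventually_not] at h₂
    obtain ⟨a, b, hab⟩ := exists_half_graph h₁ h₂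
    exact h ⟨fun i => a i, fun j => b j, fun i j => by simp [hab]⟩
  · by_contra h₂
    rw [← Ultrafilter.eventually_not] at h₂
    simp only [← Ultrafilter.eventually_not] at h₂
    obtain ⟨a, b, hab⟩ := exists_half_graph (R := fun x y => ¬ R x y) h₂
      (by simpa only [not_not] using h₁)
    -- The half graph found is for the negation. Reversing both sequences restores the direction,
    -- and the shift of `b` by one turns the resulting strict inequality into `i ≤ j`.
    refine h ⟨fun i => a (k - i), fun j => b (k - 1 - j), fun i j => ?_⟩
    rw [← not_iff_not, hab, Fin.le_def]
    omega

theorem DoubleLimit.swap (h : DoubleLimit R) : DoubleLimit fun y x => R x y :=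
  fun U V => (h V U).symm

theorem DoubleLimit.comp (h : DoubleLimit R) {X' Y' : Type*} (f : X' → X) (g : Y' → Y) :
    DoubleLimit fun x y => R (f x) (g y) := by
  intro U V
  have := h (U.map f) (V.map g)
  simpa only [Ultrafilter.coe_map, eventually_map] using this

theorem DoubleLimit.not (h : DoubleLimit R) : DoubleLimit fun x y => ¬ R x y := by
  intro U V
  simpa only [Ultrafilter.eventually_not] using not_congr (h U V)

theorem DoubleLimit.or (h : DoubleLimit R) {S : X → Y → Prop} (h' : DoubleLimit S) :
    DoubleLimit fun x y => R x y ∨ S x y := by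
  intro U V
  simpa only [Ultrafilter.eventually_or] using or_congr (h U V) (h' U V)

end DoubleLimit

/-! ### Boolean algebras separated by ultrafilters; definability of types -/

section Ultrafilter

variable {X : Type*}

theorem exists_ultrafilter_of_inter_mem (E : Set X) (F : Set (Set X)) (huniv : Set.univ ∈ F)
    (hinter : ∀ C ∈ F, ∀ C' ∈ F, C ∩ C' ∈ F) (hne : ∀ C ∈ F, (E ∩ C).Nonempty) :
    ∃ W : Ultrafilter X, E ∈ W ∧ ∀ C ∈ F, C ∈ W := by
  let b : FilterBasis X :=
    { sets := (fun C => E ∩ C) '' F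
      nonempty := ⟨_, Set.mem_image_of_mem _ huniv⟩
      inter_sets := by
        rintro _ _ ⟨C, hC, rfl⟩ ⟨C', hC', rfl⟩
        exact ⟨_, ⟨_, hinter C hC C' hC', rfl⟩, by intro x; simp; tauto⟩ }
  have hb : b.filter.NeBot := by
    rw [b.hasBasis.neBot_iff]
    rintro _ ⟨C, hC, rfl⟩
    exact hne C hC
  refine ⟨Ultrafilter.of b.filter, ?_, fun C hC => ?_⟩
  · exact Ultrafilter.of_le b.filter (b.mem_filter_iff.2 ⟨_, ⟨_, huniv, rfl⟩, by simp⟩)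
  · exact Ultrafilter.of_le b.filter (b.mem_filter_iff.2 ⟨_, ⟨_, hC, rfl⟩, by simp⟩)

/-- A set outside a Boolean subalgebra is not determined by traces of ultrafilters on it. -/
theorem exists_ultrafilters_of_notMem {B : BooleanSubalgebra (Set X)} {D : Set X} (hD : D ∉ B) :
    ∃ U V : Ultrafilter X, D ∈ U ∧ D ∉ V ∧ ∀ C ∈ B, C ∈ U ↔ C ∈ V := by
  -- `V` avoids `D` but contains every member of `B` above `D`. This is what makes the trace of `V`
  -- on `B` compatible with `D`, so that `U` can be chosen with the same trace.
  obtain ⟨V, hV, hV'⟩ := exists_ultrafilter_of_inter_mem Dᶜ {C | C ∈ B ∧ D ⊆ C}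
    ⟨B.top_mem, Set.subset_univ _⟩
    (fun C hC C' hC' => ⟨B.infClosed hC.1 hC'.1, Set.subset_inter hC.2 hC'.2⟩) (by
      rintro C ⟨hC, hDC⟩
      by_contra h
      rw [Set.not_nonempty_iff_eq_empty, Set.inter_comm, ← Set.sdiff_eq, Set.sdiff_eq_empty] at h
      exact hD (h.antisymm hDC ▸ hC))
  obtain ⟨U, hU, hU'⟩ := exists_ultrafilter_of_inter_mem D {C | C ∈ B ∧ C ∈ V}
    ⟨B.top_mem, Filter.univ_mem⟩
    (fun C hC C' hC' => ⟨B.infClosed hC.1 hC'.1, Filter.inter_mem hC.2 hC'.2⟩) (by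
      rintro C ⟨hC, hCV⟩
      by_contra h
      have hDC : D ⊆ Cᶜ := fun x hx hxC => h ⟨x, hx, hxC⟩
      exact Ultrafilter.compl_mem_iff_notMem.1 (hV' Cᶜ ⟨B.compl_mem hC, hDC⟩) hCV)
  refine ⟨U, V, hU, Ultrafilter.compl_mem_iff_notMem.1 hV, fun C hC => ⟨fun h => ?_, fun h => ?_⟩⟩
  · by_contra h'
    exact Ultrafilter.compl_mem_iff_notMem.1
      (hU' Cᶜ ⟨B.compl_mem hC, Ultrafilter.compl_mem_iff_notMem.2 h'⟩) h
  · exact hU' C ⟨hC, h⟩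

/-- Types are definable: limits of instances of a relation with the double limit property are
Boolean combinations of instances. -/
theorem DoubleLimit.limit_mem_closure {Y : Type*} {R : X → Y → Prop} (h : DoubleLimit R)
    (U : Ultrafilter X) :
    {y | ∀ᶠ x in (U : Filter X), R x y} ∈
      BooleanSubalgebra.closure (Set.range fun x => {y | R x y}) := by
  by_contra hD
  obtain ⟨V, W, hV, hW, hVW⟩ := exists_ultrafilters_of_notMem hD
  apply hW
  -- Exchange the limits, pass from `V` to `W` on each instance, and exchange back.
  refine (h U W).1 (((h U V).2 hV).mono fun x hx => ?_)
  exact (hVW _ (BooleanSubalgebra.subset_closure ⟨x, rfl⟩)).1 hx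

theorem countable_booleanSubalgebra_closure {s : Set (Set X)} (hs : s.Countable) :
    (BooleanSubalgebra.closure s : Set (Set X)).Countable := by
  let t : ℕ → Set (Set X) := fun n => Nat.rec (insert ⊥ s)
    (fun _ t => t ∪ compl '' t ∪ Set.image2 (· ⊔ ·) t t) n
  have ht : ∀ n, t (n + 1) = t n ∪ compl '' t n ∪ Set.image2 (· ⊔ ·) (t n) (t n) := fun n => rfl
  have hc : ∀ n, (t n).Countable := by
    intro n
    induction n with
    | zero => exact hs.insert _
    | succ n ih => rw [ht]; exact (ih.union (ih.image _)).union (ih.image2 ih _)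
  have hm : Monotone t := monotone_nat_of_le_succ fun n => by
    rw [ht]; exact Set.subset_union_left.trans Set.subset_union_left
  refine (Set.countable_iUnion hc).mono fun x hx => ?_
  induction hx using BooleanSubalgebra.closure_bot_sup_induction with
  | mem x hx => exact Set.mem_iUnion.2 ⟨0, Set.mem_insert_of_mem _ hx⟩
  | bot => exact Set.mem_iUnion.2 ⟨0, Set.mem_insert _ _⟩
  | sup x _ y _ hx hy =>
    obtain ⟨i, hi⟩ := Set.mem_iUnion.1 hx
    obtain ⟨j, hj⟩ := Set.mem_iUnion.1 hy
    refine Set.mem_iUnion.2 ⟨max i j + 1, ?_⟩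
    rw [ht]
    exact Or.inr ⟨x, hm (le_max_left _ _) hi, y, hm (le_max_right _ _) hj, rfl⟩
  | compl x _ hx =>
    obtain ⟨i, hi⟩ := Set.mem_iUnion.1 hx
    refine Set.mem_iUnion.2 ⟨i + 1, ?_⟩
    rw [ht]
    exact Or.inl (Or.inr ⟨x, hi, rfl⟩)

end Ultrafilter

/-! ### No binary trees; indivisible sets -/

section Scattered

variable {X Y : Type*} {R : X → Y → Prop}

/-- The first `m` values of `σ`, the latest first. -/
def branch (σ : ℕ → Bool) : ℕ → List Bool
  | 0 => []
  | m + 1 => σ m :: branch σ m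

/-- There is no binary tree of instances of a relation with the double limit property. -/
theorem DoubleLimit.not_binary_tree (h : DoubleLimit R) (C : List Bool → Set X)
    (b : List Bool → Y) (hne : ∀ s, (C s).Nonempty)
    (ht : ∀ s, C (true :: s) ⊆ C s ∩ {x | R x (b s)})
    (hf : ∀ s, C (false :: s) ⊆ C s \ {x | R x (b s)}) : False := by
  choose a ha using hne
  have hsub : ∀ (σ : ℕ → Bool) (m k : ℕ), C (branch σ (m + k)) ⊆ C (branch σ m) := by
    intro σ m k
    induction k with
    | zero => exact subset_rfl
    | succ k ih =>
      refine Set.Subset.trans ?_ ih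
      change C (σ (m + k) :: branch σ (m + k)) ⊆ _
      cases σ (m + k)
      · exact (hf _).trans Set.sdiff_subset
      · exact (ht _).trans Set.inter_subset_left
  let U : (ℕ → Bool) → Ultrafilter (List Bool) := fun σ => (hyperfilter ℕ).map (branch σ)
  have hU : ∀ σ m, ∀ᶠ s in (U σ : Filter (List Bool)), a s ∈ C (branch σ m) := by
    intro σ m
    simp only [U, Ultrafilter.coe_map, eventually_map]
    have : ∀ᶠ i in (atTop : Filter ℕ), a (branch σ i) ∈ C (branch σ m) := by
      filter_upwards [eventually_ge_atTop m] with i hi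
      obtain ⟨k, rfl⟩ := Nat.exists_eq_add_of_le hi
      exact hsub σ m k (ha _)
    exact (Nat.hyperfilter_le_atTop) this
  -- `T σ` is the limit type along the branch `σ`, as a set of nodes. On the nodes of its own branch
  -- it reads off `σ`, so it determines `σ`; by definability it lies in an algebra generated by
  -- countably many sets.
  let T : (ℕ → Bool) → Set (List Bool) := fun σ =>
    {t | ∀ᶠ s in (U σ : Filter (List Bool)), R (a s) (b t)}
  have hT : ∀ σ m, branch σ m ∈ T σ ↔ σ m = true := by
    intro σ m
    have h1 := hU σ (m + 1)
    change ∀ᶠ s in (U σ : Filter (List Bool)), a s ∈ C (σ m :: branch σ m) at h1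
    cases hσ : σ m
    · rw [hσ] at h1
      simp only [T, Set.mem_ofPred_eq, Bool.false_eq_true, iff_false]
      rw [← Ultrafilter.eventually_not]
      exact h1.mono fun s hs => (hf _ hs).2
    · rw [hσ] at h1
      simp only [T, Set.mem_ofPred_eq, iff_true]
      exact h1.mono fun s hs => (ht _ hs).2
  have hinj : Function.Injective T := by
    intro σ τ hστ
    have hb : ∀ m, branch σ m = branch τ m := by
      intro m
      induction m with
      | zero => rfl
      | succ m ih =>
        change σ m :: branch σ m = τ m :: branch τ m
        rw [ih]
        congr 1
        rw [Bool.eq_iff_iff, ← hT σ m, ← hT τ m, hστ, ih]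
    funext m
    rw [Bool.eq_iff_iff, ← hT σ m, ← hT τ m, hστ, hb]
  have hcount : (Set.range T).Countable :=
    (countable_booleanSubalgebra_closure
      (Set.countable_range fun s : List Bool => {t | R (a s) (b t)})).mono (by
        rintro _ ⟨σ, rfl⟩
        exact (h.comp a b).limit_mem_closure (U σ))
  have : Countable (ℕ → Bool) := by
    have := hcount.to_subtype
    exact (Set.rangeFactorization_injective.2 hinj).countable
  have hle := Cardinal.mk_le_aleph0_iff.2 this
  simp only [Cardinal.mk_pi, Cardinal.mk_bool, Cardinal.prod_const, Cardinal.mk_nat] at hle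
  exact hle.not_gt (by simpa using Cardinal.cantor Cardinal.aleph0)

/-- Every notion of largeness has a large Boolean combination of instances that no instance
splits into two large pieces. -/
theorem DoubleLimit.exists_indivisible (h : DoubleLimit R) (P : Set X → Prop)
    (huniv : P Set.univ) (hne : ∀ C, P C → C.Nonempty) :
    ∃ C ∈ BooleanSubalgebra.closure (Set.range fun y => {x | R x y}), P C ∧
      ∀ y, ¬ P (C ∩ {x | R x y}) ∨ ¬ P (C \ {x | R x y}) := by
  by_contra! hcon
  let B := BooleanSubalgebra.closure (Set.range fun y => {x | R x y})
  have hB : ∀ y, {x | R x y} ∈ B := fun y => BooleanSubalgebra.subset_closure ⟨y, rfl⟩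
  have : Nonempty Y := ⟨(hcon _ B.top_mem huniv).choose⟩
  choose! b hb₁ hb₂ using hcon
  let C : List Bool → Set X := fun s => List.rec Set.univ
    (fun ε _ D => if ε then D ∩ {x | R x (b D)} else D \ {x | R x (b D)}) s
  have ht : ∀ s, C (true :: s) = C s ∩ {x | R x (b (C s))} := fun s => rfl
  have hf : ∀ s, C (false :: s) = C s \ {x | R x (b (C s))} := fun s => rfl
  have hP : ∀ s, C s ∈ B ∧ P (C s) := by
    intro s
    induction s with
    | nil => exact ⟨B.top_mem, huniv⟩
    | cons ε s ih =>
      cases ε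
      · rw [hf]; exact ⟨BooleanSubalgebra.sdiff_mem ih.1 (hB _), hb₂ _ ih.1 ih.2⟩
      · rw [ht]; exact ⟨B.infClosed ih.1 (hB _), hb₁ _ ih.1 ih.2⟩
  exact h.not_binary_tree C (fun s => b (C s)) (fun s => hne _ (hP s).2)
    (fun s => (ht s).subset) (fun s => (hf s).subset)

end Scattered

/-! ### Minimal invariant filters and types with finite orbit -/

section FiniteOrbit

variable {G : Type*} [Group G]

/-- A minimal left invariant proper filter on a group. -/
theorem exists_minimal_invariant_filter (G : Type*) [Group G] :
    ∃ F : Filter G, Minimal (fun F : Filter G =>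
      F.NeBot ∧ ∀ g : G, ∀ s ∈ F, (fun x => g * x) ⁻¹' s ∈ F) F := by
  obtain ⟨F, -, hF⟩ := zorn_le_nonempty₀ (α := (Filter G)ᵒᵈ)
    {F | (OrderDual.ofDual F).NeBot ∧
      ∀ g : G, ∀ s ∈ OrderDual.ofDual F, (fun x => g * x) ⁻¹' s ∈ OrderDual.ofDual F}
    (by
      intro c hc hchain y hy
      let c' : Set (Filter G) := c
      have hdir : DirectedOn (· ≥ ·) c' := by
        intro F hF F' hF'
        rcases hchain.total hF hF' with h | h
        · exact ⟨F', hF', h, le_rfl⟩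
        · exact ⟨F, hF, le_rfl, h⟩
      refine ⟨OrderDual.toDual (sInf c'), ⟨?_, ?_⟩, fun z hz => ?_⟩
      · exact sInf_neBot_of_directed' ⟨y, hy⟩ hdir fun hbot => (hc hbot).1.ne rfl
      · intro g s hs
        change s ∈ sInf c' at hs
        change _ ∈ sInf c'
        rw [sInf_eq_iInf, mem_biInf_of_directed hdir ⟨y, hy⟩] at hs ⊢
        obtain ⟨F, hF, hs⟩ := hs
        exact ⟨F, hF, (hc hF).2 g s hs⟩
      · exact sInf_le (α := Filter G) hz)
    (OrderDual.toDual ⊤) ⟨inferInstanceAs (⊤ : Filter G).NeBot, fun g s hs => by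
      change s ∈ (⊤ : Filter G) at hs
      change _ ∈ (⊤ : Filter G)
      rw [mem_top] at hs ⊢
      simp [hs]⟩
  exact ⟨F, hF.1, fun F' hF' hle => hF.2 hF' hle⟩

/-- Finitely many translates of a set meeting a minimal invariant filter belong to it. -/
theorem exists_finset_translates_mem {F : Filter G} (hF : Minimal (fun F : Filter G =>
      F.NeBot ∧ ∀ g : G, ∀ s ∈ F, (fun x => g * x) ⁻¹' s ∈ F) F) {C : Set G} (hC : Cᶜ ∉ F) :
    ∃ t : Finset G, ∀ᶠ x in F, ∃ g ∈ t, g * x ∈ C := by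
  classical
  by_contra! hcon
  -- If no finite `t` works, adjoining the complements of all translates of `C` gives a finer proper
  -- invariant filter. Minimality then forces `Cᶜ ∈ F`.
  let b : FilterBasis G :=
    { sets := {D | ∃ s ∈ F, ∃ t : Finset G, D = s ∩ {x | ∀ g ∈ t, g * x ∉ C}}
      nonempty := ⟨_, Set.univ, univ_mem, ∅, rfl⟩
      inter_sets := by
        rintro _ _ ⟨s, hs, t, rfl⟩ ⟨s', hs', t', rfl⟩
        refine ⟨_, ⟨s ∩ s', inter_mem hs hs', t ∪ t', rfl⟩, ?_⟩
        rintro x ⟨⟨h1, h2⟩, h3⟩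
        exact ⟨⟨h1, fun g hg => h3 g (Finset.mem_union_left _ hg)⟩,
          h2, fun g hg => h3 g (Finset.mem_union_right _ hg)⟩ }
  have hle : b.filter ≤ F := fun s hs =>
    b.mem_filter_iff.2 ⟨_, ⟨s, hs, ∅, rfl⟩, Set.inter_subset_left⟩
  have hb : b.filter.NeBot := by
    rw [b.hasBasis.neBot_iff]
    rintro _ ⟨s, hs, t, rfl⟩
    by_contra h
    refine hcon t (mem_of_superset hs fun x hx => ?_)
    by_contra hx'
    refine h ⟨x, hx, fun g hg hgx => hx' fun h => h g hg hgx⟩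
  have hinv : ∀ g : G, ∀ s ∈ b.filter, (fun x => g * x) ⁻¹' s ∈ b.filter := by
    intro g s hs
    obtain ⟨_, ⟨s', hs', t, rfl⟩, hsub⟩ := b.mem_filter_iff.1 hs
    refine b.mem_filter_iff.2 ⟨_, ⟨_, hF.1.2 g s' hs', t.image (· * g), rfl⟩, ?_⟩
    rintro x ⟨hx₁, hx₂⟩
    refine hsub ⟨hx₁, fun h hh => ?_⟩
    rw [← mul_assoc]
    exact hx₂ _ (Finset.mem_image_of_mem _ hh)
  refine hC (hF.2 ⟨hb, hinv⟩ hle (b.mem_filter_iff.2 ⟨_, ⟨_, univ_mem, {1}, rfl⟩, ?_⟩))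
  rintro x ⟨-, hx⟩
  simpa using hx

/-- A stable left invariant relation has a type with finite orbit. -/
theorem DoubleLimit.exists_finite_orbit {Y : Type*} {R : G → Y → Prop} (h : DoubleLimit R)
    (hinv : ∀ (g : G) (y : Y), ∃ y', ∀ x, R (g * x) y ↔ R x y') :
    ∃ (V : Ultrafilter G) (M : Subgroup G), M.FiniteIndex ∧ ∀ g ∈ M, ∀ y,
      (∀ᶠ x in (V : Filter G), R (g * x) y) ↔ ∀ᶠ x in (V : Filter G), R x y := by
  obtain ⟨F, hF⟩ := exists_minimal_invariant_filter G
  have := hF.1.1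
  obtain ⟨C, -, hPC, hC⟩ := h.exists_indivisible (fun C => Cᶜ ∉ F) (by simp [empty_notMem])
    (fun C hC => by
      by_contra hne
      rw [Set.not_nonempty_iff_eq_empty] at hne
      simp [hne] at hC)
  obtain ⟨t, ht⟩ := exists_finset_translates_mem hF hPC
  have hne : (F ⊓ 𝓟 C).NeBot := by
    rw [inf_principal_neBot_iff]
    intro s hs
    by_contra hs'
    refine hPC (mem_of_superset hs fun x hx hxC => hs' ⟨x, hx, hxC⟩)
  let V := Ultrafilter.of (F ⊓ 𝓟 C)
  have hVF : (V : Filter G) ≤ F := (Ultrafilter.of_le _).trans inf_le_left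
  have hVC : C ∈ V := (Ultrafilter.of_le (F ⊓ 𝓟 C)) (mem_inf_of_right (mem_principal_self C))
  -- Since no instance splits `C` into two pieces positive for `F`, the filter `F` and the set `C`
  -- decide every instance.
  have hdet : ∀ W : Ultrafilter G, (W : Filter G) ≤ F → C ∈ W → ∀ y,
      (∀ᶠ x in (W : Filter G), R x y) ↔ ∀ᶠ x in (V : Filter G), R x y := by
    have hone : ∀ W : Ultrafilter G, (W : Filter G) ≤ F → C ∈ W → ∀ y,
        (∀ᶠ x in (W : Filter G), R x y) ↔ (C \ {x | R x y})ᶜ ∈ F := by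
      intro W hW hCW y
      refine ⟨fun hy => ?_, fun hy => ?_⟩
      · refine (hC y).elim (fun h1 => ?_) not_not.1
        have h2 := hW (not_not.1 h1)
        exact (W.compl_mem_iff_notMem.1 h2 (inter_mem hCW hy)).elim
      · filter_upwards [hW hy, hCW] with x hx hxC
        by_contra hR
        exact hx ⟨hxC, hR⟩
    intro W hW hCW y
    rw [hone W hW hCW, hone V hVF hVC]
  let M : Subgroup G :=
    { carrier := {g | ∀ y, (∀ᶠ x in (V : Filter G), R (g * x) y) ↔ ∀ᶠ x in (V : Filter G), R x y}
      one_mem' := fun y => by simp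
      mul_mem' := by
        intro g g' hg hg' y
        obtain ⟨y', hy'⟩ := hinv g y
        have h1 := hg' y'
        simp only [← hy', ← mul_assoc] at h1
        exact h1.trans (hg y)
      inv_mem' := by
        intro g hg y
        obtain ⟨y', hy'⟩ := hinv g⁻¹ y
        have h1 := hg y'
        simp only [← hy', inv_mul_cancel_left] at h1
        exact h1.symm }
  refine ⟨V, M, ?_, fun g hg y => hg y⟩
  -- Some `k ∈ t` moves the translate of `V` by `g` back into `C`. The result still refines `F`, so
  -- it has the same trace as `V`, and `k * g` stabilizes that trace.
  have hcover : ∀ g : G, ∃ k ∈ t, k * g ∈ M := by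
    intro g
    have h1 : ∀ᶠ x in (V : Filter G), ∃ k ∈ (t : Set G), k * (g * x) ∈ C := by
      exact hVF (hF.1.2 g _ ht)
    rw [Ultrafilter.eventually_exists_mem_iff t.finite_toSet] at h1
    obtain ⟨k, hk, hkC⟩ := h1
    refine ⟨k, hk, fun y => ?_⟩
    have := hdet (V.map fun x => k * g * x) (fun s hs => hVF (hF.1.2 (k * g) s hs))
      (by
        rw [Ultrafilter.mem_map]
        filter_upwards [hkC] with x hx
        simpa [mul_assoc] using hx) y
    simpa using this
  have : Finite (G ⧸ M) := by
    refine Set.finite_univ_iff.1 ((t.finite_toSet.image fun k => ((k⁻¹ : G) : G ⧸ M)).subset ?_)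
    rintro q -
    obtain ⟨g, rfl⟩ := QuotientGroup.mk_surjective q
    obtain ⟨k, hk, hkg⟩ := hcover g
    refine ⟨k, hk, ?_⟩
    rw [QuotientGroup.eq]
    simpa using hkg
  exact Subgroup.finiteIndex_of_finite_quotient

end FiniteOrbit

/-! ### Generic sets -/

section Generic

variable {G : Type*} [Group G]

theorem isGeneric_iff {A : Set G} : IsGeneric A ↔ ∃ F : Finset G, ∀ x, ∃ g ∈ F, g * x ∈ A := by
  classical
  constructor
  · rintro ⟨F, hF⟩
    refine ⟨F.image (·⁻¹), fun x => ?_⟩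
    have hx : x ∈ ⋃ g ∈ F, g • A := hF ▸ Set.mem_univ x
    simp only [Set.mem_iUnion, Set.mem_smul_set_iff_inv_smul_mem, smul_eq_mul] at hx
    obtain ⟨g, hg, hx⟩ := hx
    exact ⟨g⁻¹, Finset.mem_image_of_mem _ hg, hx⟩
  · rintro ⟨F, hF⟩
    refine ⟨F.image (·⁻¹), Set.eq_univ_of_forall fun x => ?_⟩
    obtain ⟨g, hg, hx⟩ := hF x
    simp only [Set.mem_iUnion, Set.mem_smul_set_iff_inv_smul_mem, smul_eq_mul]
    exact ⟨g⁻¹, Finset.mem_image_of_mem _ hg, by simpa using hx⟩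

theorem IsGeneric.mono {A B : Set G} (h : IsGeneric A) (hAB : A ⊆ B) : IsGeneric B := by
  rw [isGeneric_iff] at h ⊢
  obtain ⟨F, hF⟩ := h
  refine ⟨F, fun x => ?_⟩
  obtain ⟨g, hg, hx⟩ := hF x
  exact ⟨g, hg, hAB hx⟩

theorem IsGeneric.of_preimage {A : Set G} {g : G} (h : IsGeneric {x | g * x ∈ A}) :
    IsGeneric A := by
  classical
  rw [isGeneric_iff] at h ⊢
  obtain ⟨F, hF⟩ := h
  refine ⟨F.image (g * ·), fun x => ?_⟩
  obtain ⟨k, hk, hx⟩ := hF x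
  exact ⟨g * k, Finset.mem_image_of_mem _ hk, by simpa [mul_assoc] using hx⟩

/-- A generic set has a translate in every ultrafilter. -/
theorem IsGeneric.exists_eventually {A : Set G} (h : IsGeneric A) (V : Ultrafilter G) :
    ∃ g : G, ∀ᶠ x in (V : Filter G), g * x ∈ A := by
  obtain ⟨F, hF⟩ := isGeneric_iff.1 h
  have h1 : ∀ᶠ x in (V : Filter G), ∃ g ∈ (F : Set G), g * x ∈ A := Eventually.of_forall hF
  rw [Ultrafilter.eventually_exists_mem_iff F.finite_toSet] at h1
  obtain ⟨g, -, hg⟩ := h1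
  exact ⟨g, hg⟩

/-- Failure of genericity is exactly the finite intersection property for the complements of the
translates of `A`. -/
theorem exists_ultrafilter_of_not_isGeneric {A : Set G} (h : ¬ IsGeneric A) :
    ∃ W : Ultrafilter G, ∀ g : G, ∀ᶠ x in (W : Filter G), g * x ∉ A := by
  classical
  rw [isGeneric_iff] at h
  push Not at h
  let b : FilterBasis G :=
    { sets := Set.range fun F : Finset G => {x | ∀ g ∈ F, g * x ∉ A}
      nonempty := Set.range_nonempty _
      inter_sets := by
        rintro _ _ ⟨F, rfl⟩ ⟨F', rfl⟩
        exact ⟨_, ⟨F ∪ F', rfl⟩, fun x hx => ⟨fun g hg => hx g (Finset.mem_union_left _ hg),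
          fun g hg => hx g (Finset.mem_union_right _ hg)⟩⟩ }
  have hb : b.filter.NeBot := by
    rw [b.hasBasis.neBot_iff]
    rintro _ ⟨F, rfl⟩
    exact h F
  refine ⟨Ultrafilter.of b.filter, fun g => Ultrafilter.of_le b.filter ?_⟩
  exact b.mem_filter_iff.2 ⟨_, ⟨{g}, rfl⟩, fun x hx => hx g (Finset.mem_singleton_self g)⟩

/-- A nonempty set invariant under a finite index normal subgroup is generic. -/
theorem isGeneric_of_invariant {A : Set G} {M : Subgroup G} [M.FiniteIndex] [M.Normal]
    (hA : A.Nonempty) (hM : ∀ m ∈ M, ∀ x, m * x ∈ A ↔ x ∈ A) : IsGeneric A := by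
  classical
  rw [isGeneric_iff]
  obtain ⟨a, ha⟩ := hA
  have := Fintype.ofFinite (G ⧸ M)
  refine ⟨(Finset.univ : Finset (G ⧸ M)).image fun q => a * q.out⁻¹, fun x => ?_⟩
  refine ⟨_, Finset.mem_image_of_mem _ (Finset.mem_univ (x : G ⧸ M)), ?_⟩
  have h1 : (x : G ⧸ M).out⁻¹ * x ∈ M := by
    rw [← QuotientGroup.eq, QuotientGroup.out_eq']
  have h2 := Subgroup.Normal.conj_mem ‹M.Normal› _ h1 a
  have h3 := (hM _ h2 a).2 ha
  simpa [mul_assoc] using h3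

theorem isGeneric_subgroup (H : Subgroup G) [H.FiniteIndex] : IsGeneric (H : Set G) := by
  refine (isGeneric_of_invariant (A := (H.normalCore : Set G)) (M := H.normalCore)
    ⟨1, one_mem _⟩ fun m hm x => ?_).mono H.normalCore_le
  exact Subgroup.mul_mem_cancel_left _ hm

end Generic

theorem IsStable.doubleLimit {G : Type*} {n : ℕ} {δ : G → (Fin n → G) → Prop}
    (h : IsStable δ) : DoubleLimit δ := by
  obtain ⟨k, -, hk⟩ := h
  exact DoubleLimit.of_no_half_graph k hk

/-! ### Approximating definable sets by invariant ones -/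

section DefAlg

variable {G : Type*} [Group G] {n : ℕ} {δ : G → (Fin n → G) → Prop}

theorem preimage_mul_mem_defAlg (hinv : IsLeftInvariantRel δ) (g : G) {φ : Set G}
    (hφ : φ ∈ DefAlg δ) : {x | g * x ∈ φ} ∈ DefAlg δ := by
  refine BooleanSubalgebra.closure_bot_sup_induction (p := fun φ _ => {x | g * x ∈ φ} ∈ DefAlg δ)
    ?_ ?_ ?_ ?_ hφ
  · rintro _ ⟨b, rfl⟩
    obtain ⟨c, hc⟩ := hinv b g
    have : {x | g * x ∈ {x : G | δ x b}} = {x | δ x c} := Set.ext hc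
    rw [this]
    exact BooleanSubalgebra.subset_closure ⟨c, rfl⟩
  · exact (DefAlg δ).bot_mem
  · intro x _ y _ hx hy
    exact (DefAlg δ).supClosed hx hy
  · intro x _ hx
    exact (DefAlg δ).compl_mem hx

theorem smul_mem_defAlg (hinv : IsLeftInvariantRel δ) (g : G) {φ : Set G}
    (hφ : φ ∈ DefAlg δ) : g • φ ∈ DefAlg δ := by
  convert preimage_mul_mem_defAlg hinv g⁻¹ hφ using 1
  ext x
  exact Set.mem_smul_set_iff_inv_smul_mem

/-- By invariance, translating an instance only changes its parameter, so on generators the relation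
is a pullback of `δ` with its sides exchanged. -/
theorem doubleLimit_mul_mem (hδ : DoubleLimit δ) (hinv : IsLeftInvariantRel δ) {φ : Set G}
    (hφ : φ ∈ DefAlg δ) : DoubleLimit fun g x => g * x ∈ φ := by
  refine BooleanSubalgebra.closure_bot_sup_induction
    (p := fun φ _ => DoubleLimit fun g x => g * x ∈ φ) ?_ ?_ ?_ ?_ hφ
  · rintro _ ⟨b, rfl⟩
    choose c hc using hinv b
    have : (fun g x => g * x ∈ {x : G | δ x b}) = fun g x => δ x (c g) := by
      funext g x
      exact propext (hc g x)
    rw [this]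
    exact (hδ.comp id c).swap
  · intro U V
    simp only [Set.bot_eq_empty, Set.mem_empty_iff_false, eventually_const]
  · intro x _ y _ hx hy
    exact hx.or hy
  · intro x _ hx
    exact hx.not

/-- The trace of `V` on `DefAlg δ` is invariant under the subgroup `N`. -/
def IsStabilizedBy (δ : G → (Fin n → G) → Prop) (V : Ultrafilter G) (N : Subgroup G) : Prop :=
  ∀ g ∈ N, ∀ φ ∈ DefAlg δ,
    (∀ᶠ x in (V : Filter G), g * x ∈ φ) ↔ ∀ᶠ x in (V : Filter G), x ∈ φ

theorem isStabilizedBy_of_forall_rel {V : Ultrafilter G} {N : Subgroup G}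
    (h : ∀ g ∈ N, ∀ b, (∀ᶠ x in (V : Filter G), δ (g * x) b) ↔ ∀ᶠ x in (V : Filter G), δ x b) :
    IsStabilizedBy δ V N := by
  intro g hg φ hφ
  refine BooleanSubalgebra.closure_bot_sup_induction
    (p := fun φ _ => (∀ᶠ x in (V : Filter G), g * x ∈ φ) ↔ ∀ᶠ x in (V : Filter G), x ∈ φ)
    ?_ ?_ ?_ ?_ hφ
  · rintro _ ⟨b, rfl⟩
    exact h g hg b
  · simp
  · intro x _ y _ hx hy
    exact Ultrafilter.eventually_or.trans ((or_congr hx hy).trans Ultrafilter.eventually_or.symm)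
  · intro x _ hx
    exact Ultrafilter.eventually_not.trans ((not_congr hx).trans Ultrafilter.eventually_not.symm)

theorem IsStabilizedBy.mono {V : Ultrafilter G} {N N' : Subgroup G} (h : IsStabilizedBy δ V N)
    (hle : N' ≤ N) : IsStabilizedBy δ V N' :=
  fun g hg => h g (hle hg)

/-- The translate of `V` by `g` depends, on `DefAlg δ`, only on the coset of `g` modulo `N`. -/
theorem IsStabilizedBy.congr (hinv : IsLeftInvariantRel δ) {V : Ultrafilter G} {N : Subgroup G}
    (h : IsStabilizedBy δ V N) {g g' : G} (hg : g⁻¹ * g' ∈ N) {φ : Set G} (hφ : φ ∈ DefAlg δ) :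
    (∀ᶠ x in (V : Filter G), g * x ∈ φ) ↔ ∀ᶠ x in (V : Filter G), g' * x ∈ φ := by
  have := h _ hg _ (preimage_mul_mem_defAlg hinv g hφ)
  simp only [Set.mem_ofPred_eq, ← mul_assoc, mul_inv_cancel, one_mul] at this
  exact this.symm

theorem exists_isStabilizedBy (hδ : DoubleLimit δ) (hinv : IsLeftInvariantRel δ) :
    ∃ (V : Ultrafilter G) (N : Subgroup G), N.FiniteIndex ∧ N.Normal ∧ IsStabilizedBy δ V N := by
  obtain ⟨V, M, hM, hV⟩ := hδ.exists_finite_orbit fun g b => hinv b g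
  exact ⟨V, M.normalCore, inferInstance, inferInstance,
    (isStabilizedBy_of_forall_rel hV).mono M.normalCore_le⟩

/-- Along a type with finite orbit, a definable set agrees with one that is invariant under a
finite index subgroup; and the members of such a type are generic. -/
theorem IsStabilizedBy.exists_invariant (hδ : DoubleLimit δ) (hinv : IsLeftInvariantRel δ)
    {V : Ultrafilter G} {N : Subgroup G} [N.FiniteIndex] [N.Normal] (hV : IsStabilizedBy δ V N)
    {φ : Set G} (hφ : φ ∈ DefAlg δ) :
    (∃ ψ ∈ DefAlg δ, (∃ M : Subgroup G, M.FiniteIndex ∧ M.Normal ∧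
        ∀ m ∈ M, ∀ x, m * x ∈ ψ ↔ x ∈ ψ) ∧
      ∀ g, (∀ᶠ x in (V : Filter G), g * x ∈ φ) ↔ ∀ᶠ x in (V : Filter G), g * x ∈ ψ) ∧
    ((∀ᶠ x in (V : Filter G), x ∈ φ) → IsGeneric φ) := by
  have hR : DoubleLimit fun g x : G => g⁻¹ * x ∈ φ :=
    (doubleLimit_mul_mem hδ hinv hφ).comp (·⁻¹) id
  -- The translating element is now the variable: left translating it amounts to moving the point
  -- `x`, so the limit set `χ` is invariant under `M'`.
  obtain ⟨U, M', hM', hU⟩ := hR.exists_finite_orbit fun g y => ⟨g⁻¹ * y, fun x => by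
    simp [mul_assoc]⟩
  let M := M'.normalCore
  let χ : Set G := {x | ∀ᶠ g in (U : Filter G), g⁻¹ * x ∈ φ}
  have hχ : χ ∈ DefAlg δ := by
    have h1 := hR.limit_mem_closure U
    refine (BooleanSubalgebra.closure_le.2 ?_) h1
    rintro _ ⟨g, rfl⟩
    exact preimage_mul_mem_defAlg hinv g⁻¹ hφ
  have hχM : ∀ m ∈ M, ∀ x, m * x ∈ χ ↔ x ∈ χ := by
    intro m hm x
    have h1 := hU m⁻¹ (inv_mem (M'.normalCore_le hm)) x
    simp only [mul_inv_rev, inv_inv, mul_assoc] at h1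
    exact h1
  -- `U` concentrates on one coset of `N`. After the exchange of limits, the inner `V`-limit is
  -- therefore constant, with value that of the representative `k`.
  obtain ⟨k, hk⟩ : ∃ k : G, ∀ᶠ g in (U : Filter G), k⁻¹ * g ∈ N := by
    obtain ⟨k, hk⟩ := (isGeneric_subgroup N).exists_eventually U
    exact ⟨k⁻¹, by simpa using hk⟩
  have hχV : ∀ g, (∀ᶠ x in (V : Filter G), g * x ∈ χ) ↔
      ∀ᶠ x in (V : Filter G), k⁻¹ * g * x ∈ φ := by
    intro g
    have h1 := (hR.comp id (g * ·)) U V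
    refine h1.symm.trans ?_
    have h2 : ∀ᶠ h in (U : Filter G), ((∀ᶠ x in (V : Filter G), h⁻¹ * (g * x) ∈ φ) ↔
        ∀ᶠ x in (V : Filter G), k⁻¹ * g * x ∈ φ) := by
      filter_upwards [hk] with h hh
      simp only [← mul_assoc h⁻¹]
      refine hV.congr hinv ?_ hφ
      have h3 := Subgroup.Normal.conj_mem ‹N.Normal› _ hh (g⁻¹ * k)
      simpa [mul_assoc] using h3
    constructor
    · intro h3
      obtain ⟨h, h4, h5⟩ := (h2.and h3).exists
      exact h4.1 h5
    · intro h3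
      exact h2.mono fun h h4 => h4.2 h3
  refine ⟨⟨{x | k * x ∈ χ}, preimage_mul_mem_defAlg hinv k hχ,
    ⟨M, inferInstance, inferInstance, fun m hm x => ?_⟩, fun g => ?_⟩, fun hφV => ?_⟩
  · have h1 := hχM _ (Subgroup.Normal.conj_mem inferInstance m hm k) (k * x)
    simpa [mul_assoc] using h1
  · have h1 := hχV (k * g)
    simpa [mul_assoc] using h1.symm
  · by_contra hgen
    obtain ⟨W, hW⟩ := exists_ultrafilter_of_not_isGeneric hgen
    have hne : χ.Nonempty := by
      have h1 := (hχV k).2 (by simpa using hφV)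
      obtain ⟨x, hx⟩ := h1.exists
      exact ⟨_, hx⟩
    -- `W` avoids every translate of `φ`, but the generic set `χ` has a translate in `W`. Exchanging
    -- `U` and `W` puts a translate of `φ` in `W`.
    obtain ⟨y, hy⟩ := (isGeneric_of_invariant hne hχM).exists_eventually W
    have h1 := ((hR.comp id (y * ·)) U W).2 hy
    obtain ⟨h, hh⟩ := h1.exists
    have h2 := hW (h⁻¹ * y)
    obtain ⟨x, hx1, hx2⟩ := (hh.and h2).exists
    exact hx2 (by simpa [mul_assoc] using hx1)

theorem IsStabilizedBy.isGeneric_of_mem (hδ : DoubleLimit δ) (hinv : IsLeftInvariantRel δ)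
    {V : Ultrafilter G} {N : Subgroup G} [N.FiniteIndex] [N.Normal] (hV : IsStabilizedBy δ V N)
    {φ : Set G} (hφ : φ ∈ DefAlg δ) {g : G} (h : ∀ᶠ x in (V : Filter G), g * x ∈ φ) :
    IsGeneric φ :=
  ((hV.exists_invariant hδ hinv (preimage_mul_mem_defAlg hinv g hφ)).2 h).of_preimage

/-- The union of two nongeneric definable sets is nongeneric. -/
theorem isGeneric_or_of_union (hδ : DoubleLimit δ) (hinv : IsLeftInvariantRel δ) {A B : Set G}
    (hA : A ∈ DefAlg δ) (hB : B ∈ DefAlg δ) (h : IsGeneric (A ∪ B)) :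
    IsGeneric A ∨ IsGeneric B := by
  obtain ⟨V, N, _, _, hV⟩ := exists_isStabilizedBy hδ hinv
  obtain ⟨g, hg⟩ := h.exists_eventually V
  rcases Ultrafilter.eventually_or.1 hg with h | h
  · exact Or.inl (hV.isGeneric_of_mem hδ hinv hA h)
  · exact Or.inr (hV.isGeneric_of_mem hδ hinv hB h)

/-- Every definable set agrees, up to a nongeneric set, with a definable set that is invariant
under a finite index subgroup. -/
theorem exists_invariant_symmDiff (hδ : DoubleLimit δ) (hinv : IsLeftInvariantRel δ)
    {φ : Set G} (hφ : φ ∈ DefAlg δ) :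
    ∃ ψ ∈ DefAlg δ, (∃ M : Subgroup G, M.FiniteIndex ∧ M.Normal ∧
        ∀ m ∈ M, ∀ x, m * x ∈ ψ ↔ x ∈ ψ) ∧ ¬ IsGeneric (symmDiff φ ψ) := by
  obtain ⟨V, N, _, _, hV⟩ := exists_isStabilizedBy hδ hinv
  obtain ⟨⟨ψ, hψ, hM, hφψ⟩, -⟩ := hV.exists_invariant hδ hinv hφ
  refine ⟨ψ, hψ, hM, fun hgen => ?_⟩
  obtain ⟨g, hg⟩ := hgen.exists_eventually V
  rcases Ultrafilter.eventually_or.1 hg with h | h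
  · obtain ⟨x, hx1, hx2⟩ := (((hφψ g).1 (h.mono fun x hx => hx.1)).and h).exists
    exact hx2.2 hx1
  · obtain ⟨x, hx1, hx2⟩ := (((hφψ g).2 (h.mono fun x hx => hx.1)).and h).exists
    exact hx2.2 hx1

end DefAlg

/-! ### The smallest definable subgroup of finite index -/

section Component

variable {G : Type*} [Group G] {n : ℕ} {δ : G → (Fin n → G) → Prop}

/-- A definable subgroup of finite index contains every normal subgroup stabilizing a type. -/
theorem IsStabilizedBy.le_of_mem_defAlg (hinv : IsLeftInvariantRel δ)
    {V : Ultrafilter G} {N : Subgroup G} [N.Normal] (hV : IsStabilizedBy δ V N)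
    (H : Subgroup G) [H.FiniteIndex] (hH : (H : Set G) ∈ DefAlg δ) : N ≤ H := by
  intro m hm
  obtain ⟨g, hg⟩ := (isGeneric_subgroup H).exists_eventually V
  have hm' : g⁻¹ * (g * (g⁻¹ * m * g)) ∈ N := by
    have := Subgroup.Normal.conj_mem ‹N.Normal› m hm g⁻¹
    simpa [mul_assoc] using this
  have h1 := (hV.congr hinv hm' hH).1 hg
  obtain ⟨x, hx1, hx2⟩ := (hg.and h1).exists
  have h3 := H.mul_mem hx2 (H.inv_mem hx1)
  simpa [mul_assoc] using h3

variable (δ) in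
/-- `H` is the smallest subgroup of finite index that belongs to `DefAlg δ`. -/
def IsComponent (H : Subgroup G) : Prop :=
  H.FiniteIndex ∧ (H : Set G) ∈ DefAlg δ ∧
    ∀ K : Subgroup G, K.FiniteIndex → (K : Set G) ∈ DefAlg δ → H ≤ K

/-- All candidates contain one subgroup `N` of finite index, so they are determined by their images
in the finite quotient by `N`, and a finite intersection suffices. -/
theorem exists_isComponent (hδ : DoubleLimit δ) (hinv : IsLeftInvariantRel δ) :
    ∃ H : Subgroup G, IsComponent δ H := by
  obtain ⟨V, N, _, _, hV⟩ := exists_isStabilizedBy hδ hinv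
  let S : Set (Subgroup G) := {H | H.FiniteIndex ∧ (H : Set G) ∈ DefAlg δ}
  have hS : S.Finite := by
    have hinj : Set.InjOn (fun H : Subgroup G => (QuotientGroup.mk '' (H : Set G) : Set (G ⧸ N)))
        S := by
      have key : ∀ H ∈ S, ∀ H' ∈ S,
          (QuotientGroup.mk '' (H : Set G) : Set (G ⧸ N)) = QuotientGroup.mk '' (H' : Set G) →
          H ≤ H' := by
        intro H _ H' hH' heq x hx
        have h1 : (x : G ⧸ N) ∈ (QuotientGroup.mk '' (H' : Set G) : Set (G ⧸ N)) :=
          heq ▸ Set.mem_image_of_mem _ hx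
        obtain ⟨y, hy, hyx⟩ := h1
        have := hH'.1
        have h2 := hV.le_of_mem_defAlg hinv H' hH'.2 (QuotientGroup.eq.1 hyx)
        exact (H'.mul_mem_cancel_left (H'.inv_mem hy)).1 h2
      intro H hH H' hH' heq
      exact le_antisymm (key H hH H' hH' heq) (key H' hH' H hH heq.symm)
    exact Set.Finite.of_finite_image (Set.toFinite _) hinj
  have hinf : ∀ T : Set (Subgroup G), T.Finite → T ⊆ S → sInf T ∈ S := by
    intro T hT
    induction T, hT using Set.Finite.induction_on with
    | empty =>
      intro _
      rw [sInf_empty]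
      exact ⟨inferInstance, (DefAlg δ).top_mem⟩
    | @insert H T _ _ ih =>
      intro hTS
      have h1 := ih ((Set.subset_insert _ _).trans hTS)
      have h2 := hTS (Set.mem_insert _ _)
      have := h1.1
      have := h2.1
      rw [sInf_insert]
      exact ⟨inferInstance, (DefAlg δ).infClosed h2.2 h1.2⟩
  have h := hinf S hS subset_rfl
  exact ⟨sInf S, h.1, h.2, fun K hK hK' => sInf_le ⟨hK, hK'⟩⟩

/-- The right stabilizer of a set. -/
def rightStabilizer (A : Set G) : Subgroup G where
  carrier := {y | ∀ x, x * y ∈ A ↔ x ∈ A}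
  one_mem' x := by simp
  mul_mem' := by
    intro y z hy hz x
    rw [← mul_assoc]
    exact (hz _).trans (hy x)
  inv_mem' := by
    intro y hy x
    have := hy (x * y⁻¹)
    simpa using this.symm

theorem rightStabilizer_subgroup (H : Subgroup G) : rightStabilizer (H : Set G) = H := by
  ext y
  refine ⟨fun h => ?_, fun h x => Subgroup.mul_mem_cancel_right H h⟩
  simpa using (h 1).2 H.one_mem

/-- The normal core of the right stabilizer also stabilizes `A` on the left. The condition at `x`
thus depends only on the coset of `x`, leaving finitely many left translates of `A` or its
complement to intersect. -/
theorem rightStabilizer_mem_defAlg (hinv : IsLeftInvariantRel δ) {A : Set G} (hA : A ∈ DefAlg δ)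
    [(rightStabilizer A).FiniteIndex] : (rightStabilizer A : Set G) ∈ DefAlg δ := by
  let M := (rightStabilizer A).normalCore
  have hM : ∀ m ∈ M, ∀ x, m * x ∈ A ↔ x ∈ A := by
    intro m hm x
    have h1 := (rightStabilizer A).normalCore_le
      (Subgroup.Normal.conj_mem (inferInstanceAs M.Normal) m hm x⁻¹) x
    simpa [mul_assoc] using h1
  have key : (rightStabilizer A : Set G) = ⋂ q : G ⧸ M, {y | q.out * y ∈ A ↔ q.out ∈ A} := by
    ext y
    simp only [SetLike.mem_coe, Set.mem_iInter]
    refine ⟨fun h q => h _, fun h x => ?_⟩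
    have h1 : (x : G ⧸ M).out⁻¹ * x ∈ M := by
      rw [← QuotientGroup.eq, QuotientGroup.out_eq']
    have h2 := Subgroup.Normal.conj_mem (inferInstanceAs M.Normal) _ h1 (x : G ⧸ M).out
    have h3 := hM _ h2 (x : G ⧸ M).out
    have h4 := hM _ h2 ((x : G ⧸ M).out * y)
    simp only [mul_inv_cancel_left, mul_assoc] at h3 h4
    simp only [inv_mul_cancel_left, inv_mul_cancel, mul_one] at h3 h4
    rw [h3, h4]
    exact h x
  rw [key]
  have hfin : ∀ s : Finset (G ⧸ M),
      (⋂ q ∈ s, {y | q.out * y ∈ A ↔ q.out ∈ A}) ∈ DefAlg δ := by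
    classical
    intro s
    induction s using Finset.induction_on with
    | empty => simpa using (DefAlg δ).top_mem
    | insert q s _ ih =>
      rw [Finset.set_biInter_insert]
      refine (DefAlg δ).infClosed ?_ ih
      by_cases hq : q.out ∈ A
      · simpa [hq] using preimage_mul_mem_defAlg hinv q.out hA
      · simp only [hq, iff_false]
        exact (DefAlg δ).compl_mem (preimage_mul_mem_defAlg hinv q.out hA)
  have := Fintype.ofFinite (G ⧸ M)
  simpa using hfin Finset.univ

/-- Definable sets invariant under a finite index subgroup are unions of cosets of the
component. -/
theorem IsComponent.mul_mem_iff (hinv : IsLeftInvariantRel δ) {H : Subgroup G}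
    (hH : IsComponent δ H) {ψ : Set G} (hψ : ψ ∈ DefAlg δ) {M : Subgroup G} [M.FiniteIndex]
    [M.Normal] (hM : ∀ m ∈ M, ∀ x, m * x ∈ ψ ↔ x ∈ ψ) {h : G} (hh : h ∈ H) (x : G) :
    x * h ∈ ψ ↔ x ∈ ψ := by
  have hle : M ≤ rightStabilizer ψ := by
    intro m hm x
    have h1 := hM _ (Subgroup.Normal.conj_mem ‹M.Normal› m hm x) x
    simpa using h1
  have : (rightStabilizer ψ).FiniteIndex := Subgroup.finiteIndex_of_le hle
  exact hH.2.2 _ this (rightStabilizer_mem_defAlg hinv hψ) hh x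

end Component

/-! ### Complete types as traces of ultrafilters -/

section Types

variable {G : Type*} {n : ℕ} {δ : G → (Fin n → G) → Prop}

theorem isCompleteType_trace (W : Ultrafilter G) :
    IsCompleteType δ {A | A ∈ DefAlg δ ∧ A ∈ W} := by
  refine ⟨⟨fun A hA => hA.1, fun F hF => ?_⟩, ?_⟩
  · refine W.neBot.nonempty_of_mem ((sInter_mem F.finite_toSet).2 fun A hA => (hF hA).2)
  · rintro q ⟨hq, hfip⟩ hle A hA
    refine ⟨hq hA, ?_⟩
    by_contra hAW
    classical
    have hc : Aᶜ ∈ q := hle ⟨(DefAlg δ).compl_mem (hq hA), W.compl_mem_iff_notMem.2 hAW⟩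
    obtain ⟨x, hx⟩ := hfip {A, Aᶜ} (by
      intro C hC
      simp only [Finset.coe_insert, Finset.coe_singleton, Set.mem_insert_iff,
        Set.mem_singleton_iff] at hC
      rcases hC with rfl | rfl
      · exact hA
      · exact hc)
    exact hx Aᶜ (by simp) (hx A (by simp))

theorem IsCompleteType.exists_ultrafilter {p : Set (Set G)} (hp : IsCompleteType δ p) :
    ∃ W : Ultrafilter G, p = {A | A ∈ DefAlg δ ∧ A ∈ W} := by
  have hne : (generate p).NeBot := by
    rw [generate_neBot_iff]
    intro t ht hfin
    have := hp.1.2 hfin.toFinset (by simpa using ht)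
    simpa using this
  have hsub : p ⊆ {A | A ∈ DefAlg δ ∧ A ∈ Ultrafilter.of (generate p)} := fun A hA =>
    ⟨hp.1.1 hA, Ultrafilter.of_le (generate p) (mem_generate_of_mem hA)⟩
  exact ⟨Ultrafilter.of (generate p),
    hsub.antisymm (hp.2 (isCompleteType_trace _).1 hsub)⟩

end Types

/-! ### Cosets of the component and generic types -/

section Cosets

variable {G : Type*} [Group G] {n : ℕ} {δ : G → (Fin n → G) → Prop} {H : Subgroup G}

theorem mem_smul_subgroup {g x : G} : x ∈ g • (H : Set G) ↔ g⁻¹ * x ∈ H := by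
  rw [Set.mem_smul_set_iff_inv_smul_mem]
  rfl

theorem isGeneric_smul_subgroup [H.FiniteIndex] (g : G) : IsGeneric (g • (H : Set G)) := by
  refine IsGeneric.of_preimage (g := g) ((isGeneric_subgroup H).mono fun x hx => ?_)
  simpa [mem_smul_subgroup] using hx

/-- Every definable set agrees, up to a nongeneric set, with a union of cosets of the
component. -/
theorem IsComponent.exists_union_cosets (hH : IsComponent δ H) (hδ : DoubleLimit δ)
    (hinv : IsLeftInvariantRel δ) {φ : Set G} (hφ : φ ∈ DefAlg δ) :
    ∃ ψ ∈ DefAlg δ, (∀ g, ∀ x ∈ g • (H : Set G), x ∈ ψ ↔ g ∈ ψ) ∧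
      ¬ IsGeneric (symmDiff φ ψ) := by
  obtain ⟨ψ, hψ, ⟨M, _, _, hM⟩, hgen⟩ := exists_invariant_symmDiff hδ hinv hφ
  refine ⟨ψ, hψ, fun g x hx => ?_, hgen⟩
  simpa using hH.mul_mem_iff hinv hψ hM (mem_smul_subgroup.1 hx) g

/-- One of the two pieces is generic because the coset is. The other lies in `symmDiff φ ψ`, since
`ψ` contains or misses the whole coset. -/
theorem IsComponent.isGeneric_inter_iff (hH : IsComponent δ H) (hδ : DoubleLimit δ)
    (hinv : IsLeftInvariantRel δ) {φ ψ : Set G} (hφ : φ ∈ DefAlg δ)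
    (hψ : ∀ g, ∀ x ∈ g • (H : Set G), x ∈ ψ ↔ g ∈ ψ) (hgen : ¬ IsGeneric (symmDiff φ ψ)) (g : G) :
    (IsGeneric (g • (H : Set G) ∩ φ) ↔ g ∈ ψ) ∧ (IsGeneric (g • (H : Set G) \ φ) ↔ g ∉ ψ) := by
  have := hH.1
  have hC := smul_mem_defAlg hinv g hH.2.1
  have hor : IsGeneric (g • (H : Set G) ∩ φ) ∨ IsGeneric (g • (H : Set G) \ φ) := by
    refine isGeneric_or_of_union hδ hinv ((DefAlg δ).infClosed hC hφ)
      (BooleanSubalgebra.sdiff_mem hC hφ) ?_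
    rw [Set.inter_union_sdiff]
    exact isGeneric_smul_subgroup g
  by_cases hg : g ∈ ψ
  · have h1 : ¬ IsGeneric (g • (H : Set G) \ φ) := fun h =>
      hgen (h.mono fun x hx => Or.inr ⟨(hψ g x hx.1).2 hg, hx.2⟩)
    exact ⟨iff_of_true (hor.resolve_right h1) hg, iff_of_false h1 (not_not.2 hg)⟩
  · have h1 : ¬ IsGeneric (g • (H : Set G) ∩ φ) := fun h =>
      hgen (h.mono fun x hx => Or.inl ⟨hx.2, fun hx' => hg ((hψ g x hx.1).1 hx')⟩)
    exact ⟨iff_of_false h1 hg, iff_of_true (hor.resolve_left h1) hg⟩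

theorem IsComponent.xor_isGeneric (hH : IsComponent δ H) (hδ : DoubleLimit δ)
    (hinv : IsLeftInvariantRel δ) {φ : Set G} (hφ : φ ∈ DefAlg δ) (g : G) :
    Xor (IsGeneric (g • (H : Set G) ∩ φ)) (IsGeneric (g • (H : Set G) \ φ)) := by
  obtain ⟨ψ, -, hψ, hgen⟩ := hH.exists_union_cosets hδ hinv hφ
  obtain ⟨h1, h2⟩ := hH.isGeneric_inter_iff hδ hinv hφ hψ hgen g
  rw [h1, h2]
  by_cases hg : g ∈ ψ
  · exact Or.inl ⟨hg, not_not.2 hg⟩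
  · exact Or.inr ⟨hg, hg⟩

theorem IsComponent.not_isGeneric_symmDiff (hH : IsComponent δ H) (hδ : DoubleLimit δ)
    (hinv : IsLeftInvariantRel δ) {φ : Set G} (hφ : φ ∈ DefAlg δ) :
    ¬ IsGeneric (symmDiff φ
      (⋃₀ {C : Set G | (∃ g : G, C = g • (H : Set G)) ∧ IsGeneric (C ∩ φ)})) := by
  obtain ⟨ψ, -, hψ, hgen⟩ := hH.exists_union_cosets hδ hinv hφ
  have hiff := fun g => (hH.isGeneric_inter_iff hδ hinv hφ hψ hgen g).1
  convert hgen using 3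
  ext x
  constructor
  · rintro ⟨_, ⟨⟨g, rfl⟩, hg⟩, hx⟩
    exact (hψ g x hx).2 ((hiff g).1 hg)
  · intro hx
    exact ⟨_, ⟨⟨x, rfl⟩, (hiff x).2 hx⟩, mem_smul_subgroup.2 (by simp)⟩

/-- Every generic definable set belongs to a generic type. -/
theorem exists_isGenericType_mem (hδ : DoubleLimit δ) (hinv : IsLeftInvariantRel δ) {φ : Set G}
    (hφ : φ ∈ DefAlg δ) (hgen : IsGeneric φ) : ∃ p, IsGenericType δ p ∧ φ ∈ p := by
  obtain ⟨V, N, _, _, hV⟩ := exists_isStabilizedBy hδ hinv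
  obtain ⟨g, hg⟩ := hgen.exists_eventually V
  refine ⟨_, ⟨isCompleteType_trace (V.map (g * ·)), fun A hA => ?_⟩, hφ, hg⟩
  exact hV.isGeneric_of_mem hδ hinv hA.1 hA.2

/-- In a generic type containing the coset, membership of `A` is decided by which of the two pieces
of the coset cut by `A` is generic. -/
theorem IsComponent.genericType_eq (hH : IsComponent δ H) (hδ : DoubleLimit δ)
    (hinv : IsLeftInvariantRel δ) {p q : Set (Set G)} (hp : IsGenericType δ p)
    (hq : IsGenericType δ q) {g : G} (hgp : g • (H : Set G) ∈ p) (hgq : g • (H : Set G) ∈ q) :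
    p = q := by
  obtain ⟨U, rfl⟩ := hp.1.exists_ultrafilter
  obtain ⟨W, rfl⟩ := hq.1.exists_ultrafilter
  have key : ∀ W : Ultrafilter G, (∀ A ∈ {A | A ∈ DefAlg δ ∧ A ∈ W}, IsGeneric A) →
      g • (H : Set G) ∈ W → ∀ A ∈ DefAlg δ, A ∈ W ↔ IsGeneric (g • (H : Set G) ∩ A) := by
    intro W hW hgW A hA
    refine ⟨fun h => hW _ ⟨(DefAlg δ).infClosed hgp.1 hA, inter_mem hgW h⟩, fun h => ?_⟩
    by_contra hAW
    have h1 := hW _ ⟨BooleanSubalgebra.sdiff_mem hgp.1 hA,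
      inter_mem hgW (W.compl_mem_iff_notMem.2 hAW)⟩
    rcases hH.xor_isGeneric hδ hinv hA g with h2 | h2
    · exact h2.2 h1
    · exact h2.2 h
  ext A
  exact and_congr_right fun hA => (key U hp.2 hgp.2 A hA).trans (key W hq.2 hgq.2 A hA).symm

theorem IsComponent.existsUnique_genericType (hH : IsComponent δ H) (hδ : DoubleLimit δ)
    (hinv : IsLeftInvariantRel δ) (g : G) :
    ∃! p : Set (Set G), IsGenericType δ p ∧ g • (H : Set G) ∈ p := by
  have := hH.1
  obtain ⟨p, hp, hgp⟩ := exists_isGenericType_mem hδ hinv (smul_mem_defAlg hinv g hH.2.1)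
    (isGeneric_smul_subgroup g)
  exact ⟨p, ⟨hp, hgp⟩, fun q hq => hH.genericType_eq hδ hinv hq.1 hp hq.2 hgp⟩

end Cosets

/-! ### Invariant measures -/

section Measure

variable {G : Type*} [Group G] {n : ℕ} {δ : G → (Fin n → G) → Prop}

variable (δ) in
/-- A set function that restricts to a left invariant Keisler measure on `DefAlg δ`. -/
structure IsInvariantMeasure (m : Set G → ℝ) : Prop where
  nonneg : ∀ A, 0 ≤ m A
  univ : m Set.univ = 1
  add : ∀ A ∈ DefAlg δ, ∀ B ∈ DefAlg δ, Disjoint A B → m (A ∪ B) = m A + m B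
  inv : ∀ g, ∀ A ∈ DefAlg δ, m {x | g * x ∈ A} = m A

namespace IsInvariantMeasure

variable {m : Set G → ℝ}

theorem empty (hm : IsInvariantMeasure δ m) : m ∅ = 0 := by
  have := hm.add ∅ (DefAlg δ).bot_mem ∅ (DefAlg δ).bot_mem (by simp)
  simpa using this

theorem inter_add_sdiff (hm : IsInvariantMeasure δ m) {A B : Set G} (hA : A ∈ DefAlg δ)
    (hB : B ∈ DefAlg δ) :
    m (A ∩ B) + m (A \ B) = m A := by
  have hAB : A ∩ B ∈ DefAlg δ := (DefAlg δ).infClosed hA hB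
  rw [← hm.add _ hAB _ (BooleanSubalgebra.sdiff_mem hA hB)
    (Set.disjoint_sdiff_right.mono_left Set.inter_subset_right), Set.inter_union_sdiff]

theorem mono (hm : IsInvariantMeasure δ m) {A B : Set G} (hA : A ∈ DefAlg δ) (hB : B ∈ DefAlg δ)
    (h : A ⊆ B) : m A ≤ m B := by
  rw [← hm.inter_add_sdiff hB hA, Set.inter_eq_right.2 h]
  linarith [hm.nonneg (B \ A)]

theorem union_add_inter (hm : IsInvariantMeasure δ m) {A B : Set G} (hA : A ∈ DefAlg δ)
    (hB : B ∈ DefAlg δ) :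
    m (A ∪ B) + m (A ∩ B) = m A + m B := by
  have h1 := hm.add A hA (B \ A) (BooleanSubalgebra.sdiff_mem hB hA) Set.disjoint_sdiff_right
  have h2 := hm.inter_add_sdiff hB hA
  rw [Set.union_sdiff_self] at h1
  rw [Set.inter_comm] at h2
  linarith

theorem union_le (hm : IsInvariantMeasure δ m) {A B : Set G} (hA : A ∈ DefAlg δ)
    (hB : B ∈ DefAlg δ) :
    m (A ∪ B) ≤ m A + m B := by
  linarith [hm.union_add_inter hA hB, hm.nonneg (A ∩ B)]

theorem union_eq_zero (hm : IsInvariantMeasure δ m) {A B : Set G} (hA : A ∈ DefAlg δ)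
    (hB : B ∈ DefAlg δ) (h : m A = 0)
    (h' : m B = 0) : m (A ∪ B) = 0 := by
  linarith [hm.union_le hA hB, hm.nonneg (A ∪ B)]

theorem mono_null (hm : IsInvariantMeasure δ m) {A B : Set G} (hA : A ∈ DefAlg δ)
    (hB : B ∈ DefAlg δ) (h : A ⊆ B)
    (h' : m B = 0) : m A = 0 := by
  linarith [hm.mono hA hB h, hm.nonneg A]

/-- Null intersections suffice in place of disjointness, as needed for almost disjoint translates of
an atom. -/
theorem biUnion_eq_sum (hm : IsInvariantMeasure δ m) {ι : Type*} (s : Finset ι) (f : ι → Set G)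
    (hf : ∀ i, f i ∈ DefAlg δ)
    (hd : ∀ i j, i ≠ j → m (f i ∩ f j) = 0) :
    (⋃ i ∈ s, f i) ∈ DefAlg δ ∧ m (⋃ i ∈ s, f i) = ∑ i ∈ s, m (f i) := by
  classical
  induction s using Finset.induction_on with
  | empty => simpa using ⟨(DefAlg δ).bot_mem, hm.empty⟩
  | insert a s ha ih =>
    rw [Finset.set_biUnion_insert, Finset.sum_insert ha]
    refine ⟨(DefAlg δ).supClosed (hf a) ih.1, ?_⟩
    have h0 : ∀ t : Finset ι, a ∉ t →
        (⋃ i ∈ t, f a ∩ f i) ∈ DefAlg δ ∧ m (⋃ i ∈ t, f a ∩ f i) = 0 := by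
      intro t
      induction t using Finset.induction_on with
      | empty => intro _; simpa using ⟨(DefAlg δ).bot_mem, hm.empty⟩
      | insert b t hb iht =>
        intro hat
        rw [Finset.mem_insert, not_or] at hat
        have h1 := iht hat.2
        rw [Finset.set_biUnion_insert]
        have h2 := (DefAlg δ).infClosed (hf a) (hf b)
        exact ⟨(DefAlg δ).supClosed h2 h1.1, hm.union_eq_zero h2 h1.1 (hd a b hat.1) h1.2⟩
    have h1 := hm.union_add_inter (hf a) ih.1
    have h2 := (h0 s ha).2
    rw [← Set.inter_iUnion₂] at h2
    rw [h2, ih.2] at h1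
    linarith

/-- Sets of positive measure are generic. -/
theorem isGeneric_of_pos (hm : IsInvariantMeasure δ m) (hδ : DoubleLimit δ)
    (hinv : IsLeftInvariantRel δ) {φ : Set G}
    (hφ : φ ∈ DefAlg δ) (hpos : 0 < m φ) : IsGeneric φ := by
  obtain ⟨C, hC, hCpos, hsplit⟩ := hδ.exists_indivisible (fun C => 0 < m (C ∩ φ))
    (by simpa using hpos) (fun C hC => by
      by_contra hne
      rw [Set.not_nonempty_iff_eq_empty] at hne
      rw [hne, Set.empty_inter, hm.empty] at hC
      exact hC.false)
  change C ∈ DefAlg δ at hC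
  let A := C ∩ φ
  have hA : A ∈ DefAlg δ := (DefAlg δ).infClosed hC hφ
  have hApos : 0 < m A := hCpos
  have hi : ∀ χ ∈ DefAlg δ, A ∩ χ ∈ DefAlg δ := fun χ h => (DefAlg δ).infClosed hA h
  have hs : ∀ χ ∈ DefAlg δ, A \ χ ∈ DefAlg δ := fun χ h => BooleanSubalgebra.sdiff_mem hA h
  -- Indivisibility by instances propagates to Boolean combinations: `A` is an atom of `m`, and `W`
  -- below is the type concentrated on it.
  have hatom : ∀ χ ∈ DefAlg δ, m (A ∩ χ) = 0 ∨ m (A \ χ) = 0 := by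
    intro χ hχ
    refine BooleanSubalgebra.closure_bot_sup_induction
      (p := fun χ _ => m (A ∩ χ) = 0 ∨ m (A \ χ) = 0) ?_ ?_ ?_ ?_ hχ
    · rintro _ ⟨b, rfl⟩
      refine (hsplit b).imp (fun h => ?_) (fun h => ?_)
      · rw [Set.inter_right_comm]
        exact le_antisymm (not_lt.1 h) (hm.nonneg _)
      · rw [Set.inter_sdiff_right_comm]
        exact le_antisymm (not_lt.1 h) (hm.nonneg _)
    · exact Or.inl (by simpa using hm.empty)
    · intro x hx y hy ihx ihy
      change x ∈ DefAlg δ at hx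
      change y ∈ DefAlg δ at hy
      have hxy : x ∪ y ∈ DefAlg δ := (DefAlg δ).supClosed hx hy
      rcases ihx with h | h
      · rcases ihy with h' | h'
        · left
          change m (A ∩ (x ∪ y)) = 0
          rw [Set.inter_union_distrib_left]
          exact hm.union_eq_zero (hi _ hx) (hi _ hy) h h'
        · exact Or.inr (hm.mono_null (hs _ hxy) (hs _ hy)
            (Set.sdiff_subset_sdiff_right Set.subset_union_right) h')
      · exact Or.inr (hm.mono_null (hs _ hxy) (hs _ hx)
          (Set.sdiff_subset_sdiff_right Set.subset_union_left) h)
    · intro x _ ih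
      rw [← Set.sdiff_eq, Set.sdiff_compl]
      exact ih.symm
  obtain ⟨W, -, hW⟩ := exists_ultrafilter_of_inter_mem Set.univ {χ | χ ∈ DefAlg δ ∧ m (A \ χ) = 0}
    ⟨(DefAlg δ).top_mem, by simpa using hm.empty⟩
    (by
      rintro χ ⟨hχ, h⟩ χ' ⟨hχ', h'⟩
      refine ⟨(DefAlg δ).infClosed hχ hχ', ?_⟩
      rw [Set.sdiff_inter]
      exact hm.union_eq_zero (hs _ hχ) (hs _ hχ') h h')
    (by
      rintro χ ⟨-, h⟩
      by_contra hne
      rw [Set.univ_inter, Set.not_nonempty_iff_eq_empty] at hne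
      rw [hne, Set.sdiff_empty] at h
      exact hApos.ne' h)
  have hWiff : ∀ χ ∈ DefAlg δ, χ ∈ W ↔ m (A \ χ) = 0 := by
    intro χ hχ
    refine ⟨fun h => ?_, fun h => hW χ ⟨hχ, h⟩⟩
    by_contra h'
    have h1 := (hatom χ hχ).resolve_right h'
    exact W.compl_mem_iff_notMem.1
      (hW χᶜ ⟨(DefAlg δ).compl_mem hχ, by rwa [Set.sdiff_compl]⟩) h
  let M : Subgroup G :=
    { carrier := {g | ∀ χ ∈ DefAlg δ,
        (∀ᶠ x in (W : Filter G), g * x ∈ χ) ↔ ∀ᶠ x in (W : Filter G), x ∈ χ}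
      one_mem' := fun y => by simp
      mul_mem' := by
        intro g g' hg hg' χ hχ
        have h1 := hg' _ (preimage_mul_mem_defAlg hinv g hχ)
        simp only [Set.mem_ofPred_eq, ← mul_assoc] at h1
        exact h1.trans (hg χ hχ)
      inv_mem' := by
        intro g hg χ hχ
        have h1 := hg _ (preimage_mul_mem_defAlg hinv g⁻¹ hχ)
        simp only [Set.mem_ofPred_eq, inv_mul_cancel_left] at h1
        exact h1.symm }
  have hM : ∀ g, m (A ∩ {x | g * x ∈ A}) ≠ 0 → g ∈ M := by
    intro g hg
    have hA' := preimage_mul_mem_defAlg hinv g hA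
    have h1 := (hatom _ hA').resolve_left hg
    have himp : ∀ χ ∈ DefAlg δ, χ ∈ W → ∀ᶠ x in (W : Filter G), g * x ∈ χ := by
      intro χ hχ hχW
      have hχ' := preimage_mul_mem_defAlg hinv g hχ
      have h2 := (hWiff χ hχ).1 hχW
      rw [← hm.inv g _ (hs χ hχ)] at h2
      refine (hWiff _ hχ').2 (hm.mono_null (hs _ hχ')
        ((DefAlg δ).supClosed (hs _ hA') (preimage_mul_mem_defAlg hinv g (hs χ hχ))) ?_
        (hm.union_eq_zero (hs _ hA') (preimage_mul_mem_defAlg hinv g (hs χ hχ)) h1 h2))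
      rintro x ⟨hx, hx'⟩
      by_cases hxA : g * x ∈ A
      · exact Or.inr ⟨hxA, hx'⟩
      · exact Or.inl ⟨hx, hxA⟩
    intro χ hχ
    refine ⟨fun h => ?_, himp χ hχ⟩
    by_contra h'
    have h2 := himp χᶜ ((DefAlg δ).compl_mem hχ) (W.compl_mem_iff_notMem.2 h')
    obtain ⟨x, hx, hx'⟩ := (h.and h2).exists
    exact hx' hx
  have hfin : Finite (G ⧸ M) := by
    by_contra hinf
    rw [not_finite_iff_infinite] at hinf
    -- Translates of `A` by representatives of distinct cosets of `M` meet in null sets, so more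
    -- than `1 / m A` of them would have total measure above `1`.
    obtain ⟨k, hk⟩ := exists_nat_gt (1 / m A)
    obtain ⟨t, ht⟩ := Infinite.exists_subset_card_eq (G ⧸ M) k
    obtain ⟨hmem, hsum⟩ := hm.biUnion_eq_sum t (fun q => {x | q.out⁻¹ * x ∈ A})
      (fun q => preimage_mul_mem_defAlg hinv _ hA) (by
        intro q q' hne
        by_contra hpos
        have h1 : {x | q.out⁻¹ * x ∈ A} ∩ {x | q'.out⁻¹ * x ∈ A} ∈ DefAlg δ :=
          (DefAlg δ).infClosed (preimage_mul_mem_defAlg hinv q.out⁻¹ hA)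
            (preimage_mul_mem_defAlg hinv q'.out⁻¹ hA)
        rw [← hm.inv q.out _ h1] at hpos
        have h2 : q'.out⁻¹ * q.out ∈ M := by
          refine hM _ fun h => hpos ?_
          convert h using 2
          ext x
          simp [mul_assoc]
        have h3 := QuotientGroup.eq.2 h2
        rw [QuotientGroup.out_eq', QuotientGroup.out_eq'] at h3
        exact hne h3.symm)
    have hle := hm.mono hmem (DefAlg δ).top_mem (Set.subset_univ _)
    rw [hsum, Finset.sum_congr rfl fun q _ => hm.inv q.out⁻¹ A hA, Finset.sum_const, ht,
      nsmul_eq_mul] at hle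
    change _ ≤ m Set.univ at hle
    rw [hm.univ] at hle
    rw [div_lt_iff₀ hApos] at hk
    linarith
  have : M.FiniteIndex := Subgroup.finiteIndex_of_finite_quotient
  have hWM : IsStabilizedBy δ W M.normalCore := fun g hg => M.normalCore_le hg
  have hAW : A ∈ W := (hWiff A hA).2 (by simpa using hm.empty)
  exact ((hWM.exists_invariant hδ hinv hA).2 hAW).mono Set.inter_subset_right

theorem pos_of_isGeneric (hm : IsInvariantMeasure δ m) (hinv : IsLeftInvariantRel δ) {φ : Set G}
    (hφ : φ ∈ DefAlg δ)
    (hgen : IsGeneric φ) : 0 < m φ := by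
  obtain ⟨F, hF⟩ := isGeneric_iff.1 hgen
  refine (hm.nonneg φ).lt_of_ne fun h => ?_
  have h0 : ∀ t : Finset G, {x | ∃ g ∈ t, g * x ∈ φ} ∈ DefAlg δ ∧
      m {x | ∃ g ∈ t, g * x ∈ φ} = 0 := by
    classical
    intro t
    induction t using Finset.induction_on with
    | empty => simpa using ⟨(DefAlg δ).bot_mem, hm.empty⟩
    | insert a t _ ih =>
      have h1 : {x | ∃ g ∈ insert a t, g * x ∈ φ} =
          {x | a * x ∈ φ} ∪ {x | ∃ g ∈ t, g * x ∈ φ} := by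
        ext x
        simp
      have h2 := preimage_mul_mem_defAlg hinv a hφ
      rw [h1]
      exact ⟨(DefAlg δ).supClosed h2 ih.1,
        hm.union_eq_zero h2 ih.1 ((hm.inv a φ hφ).trans h.symm) ih.2⟩
  have h1 := (h0 F).2
  rw [Set.eq_univ_of_forall (s := {x | ∃ g ∈ F, g * x ∈ φ}) hF, hm.univ] at h1
  exact one_ne_zero h1

theorem pos_iff (hm : IsInvariantMeasure δ m) (hδ : DoubleLimit δ) (hinv : IsLeftInvariantRel δ)
    {φ : Set G}
    (hφ : φ ∈ DefAlg δ) : 0 < m φ ↔ IsGeneric φ :=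
  ⟨hm.isGeneric_of_pos hδ hinv hφ, hm.pos_of_isGeneric hinv hφ⟩

/-- The measure of a definable set is the proportion of the cosets of the component that it
contains up to a nongeneric set. -/
theorem eq_card_div (hm : IsInvariantMeasure δ m) (hδ : DoubleLimit δ)
    (hinv : IsLeftInvariantRel δ) {H : Subgroup G}
    (hH : IsComponent δ H) {φ ψ : Set G} (hφ : φ ∈ DefAlg δ) (hψ : ψ ∈ DefAlg δ)
    (hcoset : ∀ g, ∀ x ∈ g • (H : Set G), x ∈ ψ ↔ g ∈ ψ) (hgen : ¬ IsGeneric (symmDiff φ ψ)) :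
    m φ = (Nat.card {q : G ⧸ H // q.out ∈ ψ} : ℝ) / Nat.card (G ⧸ H) := by
  classical
  have := hH.1
  have := Fintype.ofFinite (G ⧸ H)
  have hout : ∀ x : G, x ∈ (x : G ⧸ H).out • (H : Set G) := fun x => by
    rw [mem_smul_subgroup, ← QuotientGroup.eq, QuotientGroup.out_eq']
  have hnull : ∀ χ ∈ DefAlg δ, χ ⊆ symmDiff φ ψ → m χ = 0 := by
    intro χ hχ hsub
    by_contra h
    exact hgen ((hm.isGeneric_of_pos hδ hinv hχ ((hm.nonneg χ).lt_of_ne' h)).mono hsub)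
  have hφψ : m φ = m ψ := by
    have h1 := hm.inter_add_sdiff hφ hψ
    have h2 := hm.inter_add_sdiff hψ hφ
    rw [hnull _ (BooleanSubalgebra.sdiff_mem hφ hψ) (fun x hx => Or.inl hx)] at h1
    rw [hnull _ (BooleanSubalgebra.sdiff_mem hψ hφ) (fun x hx => Or.inr hx), Set.inter_comm] at h2
    linarith
  have hcosets : ∀ s : Finset (G ⧸ H),
      m (⋃ q ∈ s, q.out • (H : Set G)) = s.card * m (H : Set G) := by
    intro s
    rw [(hm.biUnion_eq_sum s (fun q => q.out • (H : Set G))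
      (fun q => smul_mem_defAlg hinv _ hH.2.1) ?_).2, Finset.sum_congr rfl (g := fun _ => m H),
      Finset.sum_const, nsmul_eq_mul]
    · intro q _
      rw [← hm.inv q.out _ (smul_mem_defAlg hinv _ hH.2.1)]
      congr 1
      ext x
      simp [mem_smul_subgroup]
    · intro q q' hne
      have : q.out • (H : Set G) ∩ q'.out • (H : Set G) = ∅ := by
        rw [Set.eq_empty_iff_forall_notMem]
        rintro x ⟨hx, hx'⟩
        rw [mem_smul_subgroup, ← QuotientGroup.eq, QuotientGroup.out_eq'] at hx hx'
        exact hne (hx.trans hx'.symm)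
      rw [this, hm.empty]
  have huniv : (Nat.card (G ⧸ H) : ℝ) * m (H : Set G) = 1 := by
    rw [← hm.univ, Nat.card_eq_fintype_card, ← Finset.card_univ, ← hcosets]
    congr 1
    refine Set.eq_univ_of_forall fun x => ?_
    simp only [Finset.mem_univ, Set.iUnion_true, Set.mem_iUnion]
    exact ⟨_, hout x⟩
  have hunion : ψ = ⋃ q ∈ Finset.univ.filter (fun q : G ⧸ H => q.out ∈ ψ), q.out • (H : Set G) := by
    ext x
    simp only [Finset.mem_filter, Finset.mem_univ, true_and, Set.mem_iUnion, exists_prop]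
    refine ⟨fun hx => ⟨_, (hcoset _ x (hout x)).1 hx, hout x⟩, ?_⟩
    rintro ⟨q, hq, hx⟩
    exact (hcoset _ x hx).2 hq
  have hψm : m ψ = (Nat.card {q : G ⧸ H // q.out ∈ ψ} : ℝ) * m (H : Set G) := by
    conv_lhs => rw [hunion]
    rw [hcosets, Nat.card_eq_fintype_card, Fintype.card_subtype]
  rw [hφψ, hψm, eq_div_iff (left_ne_zero_of_mul_eq_one huniv), mul_assoc, mul_comm (m _), huniv,
    mul_one]

end IsInvariantMeasure

/-- The measure averages the finitely many translates of `V` over `G ⧸ N`; left translation permutes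
them. -/
theorem exists_isInvariantMeasure (hδ : DoubleLimit δ) (hinv : IsLeftInvariantRel δ) :
    ∃ m : Set G → ℝ, IsInvariantMeasure δ m := by
  classical
  obtain ⟨V, N, _, _, hV⟩ := exists_isStabilizedBy hδ hinv
  have := Fintype.ofFinite (G ⧸ N)
  have hcard : (Fintype.card (G ⧸ N) : ℝ) ≠ 0 := by
    exact_mod_cast Fintype.card_ne_zero
  refine ⟨fun A => (∑ q : G ⧸ N,
    if ∀ᶠ x in (V : Filter G), q.out * x ∈ A then (1 : ℝ) else 0) / Fintype.card (G ⧸ N),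
    ⟨fun A => ?_, ?_, fun A hA B hB hd => ?_, fun g A hA => ?_⟩⟩
  · exact div_nonneg (Finset.sum_nonneg fun q _ => by split_ifs <;> norm_num) (by positivity)
  · simp [hcard]
  · rw [← add_div, ← Finset.sum_add_distrib]
    congr 1
    refine Finset.sum_congr rfl fun q _ => ?_
    have h1 : (∀ᶠ x in (V : Filter G), q.out * x ∈ A ∪ B) ↔
      (∀ᶠ x in (V : Filter G), q.out * x ∈ A) ∨ ∀ᶠ x in (V : Filter G), q.out * x ∈ B :=
      Ultrafilter.eventually_or
    by_cases hqA : ∀ᶠ x in (V : Filter G), q.out * x ∈ A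
    · have hqB : ¬ ∀ᶠ x in (V : Filter G), q.out * x ∈ B := by
        intro hqB
        obtain ⟨x, hx, hx'⟩ := (hqA.and hqB).exists
        exact Set.disjoint_left.1 hd hx hx'
      rw [if_pos (h1.2 (Or.inl hqA)), if_pos hqA, if_neg hqB, add_zero]
    · rw [if_neg hqA, zero_add]
      refine if_congr (h1.trans (or_iff_right hqA)) rfl rfl
  · congr 1
    refine Fintype.sum_equiv (Equiv.mulLeft (g : G ⧸ N)) _ _ fun q => ?_
    refine if_congr ?_ rfl rfl
    simp only [Set.mem_ofPred_eq, ← mul_assoc]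
    refine hV.congr hinv ?_ hA
    rw [← QuotientGroup.eq, QuotientGroup.out_eq', QuotientGroup.mk_mul, QuotientGroup.out_eq']
    rfl

open Classical in
theorem isInvariantMeasure_extend (hinv : IsLeftInvariantRel δ) {μ : DefAlg δ → ℝ}
    (h : IsKeislerMeasure δ μ) (h' : IsLeftInvariantMeasure δ μ) :
    -- The default value `0` keeps the extension nonnegative on sets outside the algebra.
    IsInvariantMeasure δ fun A => if hA : A ∈ DefAlg δ then μ ⟨A, hA⟩ else 0 := by
  refine ⟨fun A => ?_, ?_, fun A hA B hB hd => ?_, fun g A hA => ?_⟩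
  · split_ifs
    · exact h.1 _
    · exact le_rfl
  · have htop : (Set.univ : Set G) ∈ DefAlg δ := (DefAlg δ).top_mem
    rw [dif_pos htop]
    exact h.2.1
  · have hAB : A ∪ B ∈ DefAlg δ := (DefAlg δ).supClosed hA hB
    rw [dif_pos hA, dif_pos hB, dif_pos hAB]
    exact h.2.2 ⟨A, hA⟩ ⟨B, hB⟩ hd
  · rw [dif_pos hA, dif_pos (preimage_mul_mem_defAlg hinv g hA)]
    refine h' g⁻¹ _ _ ?_
    ext x
    simp [Set.mem_smul_set_iff_inv_smul_mem]

theorem existsUnique_keislerMeasure (hδ : DoubleLimit δ) (hinv : IsLeftInvariantRel δ) :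
    ∃! μ : DefAlg δ → ℝ, IsKeislerMeasure δ μ ∧ IsLeftInvariantMeasure δ μ := by
  obtain ⟨m, hm⟩ := exists_isInvariantMeasure hδ hinv
  obtain ⟨H, hH⟩ := exists_isComponent hδ hinv
  refine ⟨fun A => m A, ⟨⟨fun A => hm.nonneg A, hm.univ, fun A B hd => hm.add A A.2 B B.2 hd⟩,
    fun g A B hB => ?_⟩, ?_⟩
  · change m B = m A
    rw [← hm.inv g B B.2, hB]
    congr 1
    ext x
    simp [Set.mem_smul_set_iff_inv_smul_mem]
  · rintro μ ⟨hμ, hμ'⟩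
    funext A
    obtain ⟨ψ, hψ, hcoset, hgen⟩ := hH.exists_union_cosets hδ hinv A.2
    have h1 := (isInvariantMeasure_extend hinv hμ hμ').eq_card_div hδ hinv hH A.2 hψ hcoset hgen
    rw [dif_pos A.2] at h1
    exact h1.trans (hm.eq_card_div hδ hinv hH A.2 hψ hcoset hgen).symm

theorem keislerMeasure_pos_iff (hδ : DoubleLimit δ) (hinv : IsLeftInvariantRel δ)
    {μ : DefAlg δ → ℝ} (h : IsKeislerMeasure δ μ) (h' : IsLeftInvariantMeasure δ μ)
    (φ : DefAlg δ) : 0 < μ φ ↔ IsGeneric (φ : Set G) := by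
  have := (isInvariantMeasure_extend hinv h h').pos_iff hδ hinv φ.2
  rwa [dif_pos φ.2] at this

end Measure

/-! ### First-order definability of the component -/

section Definability

open FirstOrder FirstOrder.Language

variable {G : Type*} [Group G] {n : ℕ} {δ : G → (Fin n → G) → Prop}

variable (δ) in
/-- `P` is defined by a formula without parameters in the structure `M_δ`. -/
def IsFirstOrder {α : Type} (P : (α → G) → Prop) : Prop :=
  letI := deltaStructure δ
  ∃ θ : (deltaLanguage n).Formula α, ∀ v, θ.Realize v ↔ P v

namespace IsFirstOrder

variable {α β : Type} {P Q : (α → G) → Prop}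

theorem not (hP : IsFirstOrder δ P) : IsFirstOrder δ fun v => ¬ P v := by
  let _ := deltaStructure δ
  obtain ⟨θ, hθ⟩ := hP
  exact ⟨θ.not, fun v => by rw [Formula.realize_not, hθ]⟩

theorem imp (hP : IsFirstOrder δ P) (hQ : IsFirstOrder δ Q) :
    IsFirstOrder δ fun v => P v → Q v := by
  let _ := deltaStructure δ
  obtain ⟨θ, hθ⟩ := hP
  obtain ⟨η, hη⟩ := hQ
  exact ⟨θ.imp η, fun v => by rw [Formula.realize_imp, hθ, hη]⟩

theorem or (hP : IsFirstOrder δ P) (hQ : IsFirstOrder δ Q) :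
    IsFirstOrder δ fun v => P v ∨ Q v := by
  simpa only [← or_iff_not_imp_left] using hP.not.imp hQ

theorem iff (hP : IsFirstOrder δ P) (hQ : IsFirstOrder δ Q) :
    IsFirstOrder δ fun v => P v ↔ Q v := by
  let _ := deltaStructure δ
  obtain ⟨θ, hθ⟩ := hP
  obtain ⟨η, hη⟩ := hQ
  exact ⟨θ.iff η, fun v => by rw [Formula.realize_iff, hθ, hη]⟩

theorem forall_tuple [Finite β] {P : (α ⊕ β → G) → Prop} (hP : IsFirstOrder δ P) :
    IsFirstOrder δ fun v => ∀ w : β → G, P (Sum.elim v w) := by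
  let _ := deltaStructure δ
  obtain ⟨θ, hθ⟩ := hP
  exact ⟨θ.iAlls β, fun v => by simp only [Formula.realize_iAlls, hθ]⟩

theorem exists_tuple [Finite β] {P : (α ⊕ β → G) → Prop} (hP : IsFirstOrder δ P) :
    IsFirstOrder δ fun v => ∃ w : β → G, P (Sum.elim v w) := by
  let _ := deltaStructure δ
  obtain ⟨θ, hθ⟩ := hP
  exact ⟨θ.iExs β, fun v => by simp only [Formula.realize_iExs, hθ]⟩

theorem exists_finite [Finite β] {P : β → (α → G) → Prop} (hP : ∀ i, IsFirstOrder δ (P i)) :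
    IsFirstOrder δ fun v => ∃ i, P i v := by
  let _ := deltaStructure δ
  choose θ hθ using hP
  exact ⟨Formula.iSup θ, fun v => by simp only [Formula.realize_iSup, hθ]⟩

theorem subst (hP : IsFirstOrder δ P) (t : α → (deltaLanguage n).Term β) :
    letI := deltaStructure δ
    IsFirstOrder δ fun v => P fun a => (t a).realize v := by
  let _ := deltaStructure δ
  obtain ⟨θ, hθ⟩ := hP
  exact ⟨BoundedFormula.subst θ t, fun v =>
    BoundedFormula.realize_subst.trans (hθ _)⟩

theorem relabel (hP : IsFirstOrder δ P) (f : α → β) : IsFirstOrder δ fun v => P (v ∘ f) :=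
  hP.subst fun a => Term.var (f a)

end IsFirstOrder

/-- The term `s * t`. -/
def mulTerm {α : Type} (s t : (deltaLanguage n).Term α) : (deltaLanguage n).Term α :=
  Term.func (l := 2) GroupFunc.mul ![s, t]

/-- The term `s⁻¹`. -/
def invTerm {α : Type} (s : (deltaLanguage n).Term α) : (deltaLanguage n).Term α :=
  Term.func (l := 1) GroupFunc.inv ![s]

theorem isFirstOrder_delta :
    IsFirstOrder δ fun v : Fin n ⊕ Unit → G => δ (v (Sum.inr ())) fun i => v (Sum.inl i) := by
  let _ := deltaStructure δ
  let r : (deltaLanguage n).Relations (n + 1) := DeltaRel.delta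
  refine ⟨r.formula (Fin.cons (Term.var (Sum.inr ())) fun i => Term.var (Sum.inl i)), fun v => ?_⟩
  rw [Formula.realize_rel]
  exact Iff.rfl

/-- Every member of `DefAlg δ` belongs to a first-order family of members of `DefAlg δ`. -/
theorem exists_family {φ : Set G} (hφ : φ ∈ DefAlg δ) :
    ∃ (ι : Type) (_ : Finite ι) (Ψ : (ι → G) → Set G),
      IsFirstOrder δ (fun v : ι ⊕ Unit → G => v (Sum.inr ()) ∈ Ψ (v ∘ Sum.inl)) ∧
      (∀ c, Ψ c ∈ DefAlg δ) ∧ ∃ c, Ψ c = φ := by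
  refine BooleanSubalgebra.closure_bot_sup_induction (p := fun φ _ =>
    ∃ (ι : Type) (_ : Finite ι) (Ψ : (ι → G) → Set G),
      IsFirstOrder δ (fun v : ι ⊕ Unit → G => v (Sum.inr ()) ∈ Ψ (v ∘ Sum.inl)) ∧
      (∀ c, Ψ c ∈ DefAlg δ) ∧ ∃ c, Ψ c = φ) ?_ ?_ ?_ ?_ hφ
  · rintro _ ⟨b, rfl⟩
    exact ⟨Fin n, inferInstance, fun c => {x | δ x c}, isFirstOrder_delta,
      fun c => BooleanSubalgebra.subset_closure ⟨c, rfl⟩, b, rfl⟩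
  · let _ := deltaStructure δ
    exact ⟨Empty, inferInstance, fun _ => ∅, ⟨⊥, fun v => by simp⟩,
      fun _ => (DefAlg δ).bot_mem, Empty.elim, rfl⟩
  · rintro _ _ _ _ ⟨ι, _, Ψ, hΨ, hΨ', c, rfl⟩ ⟨κ, _, Θ, hΘ, hΘ', d, rfl⟩
    refine ⟨ι ⊕ κ, inferInstance, fun e => Ψ (e ∘ Sum.inl) ∪ Θ (e ∘ Sum.inr), ?_,
      fun e => (DefAlg δ).supClosed (hΨ' _) (hΘ' _), Sum.elim c d, rfl⟩
    exact (hΨ.relabel (Sum.map Sum.inl id)).or (hΘ.relabel (Sum.map Sum.inr id))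
  · rintro _ _ ⟨ι, hι, Ψ, hΨ, hΨ', c, rfl⟩
    exact ⟨ι, hι, fun e => (Ψ e)ᶜ, hΨ.not, fun e => (DefAlg δ).compl_mem (hΨ' e), c, rfl⟩

theorem isFirstOrder_rightStabilizer {ι : Type} {Ψ : (ι → G) → Set G}
    (hΨ : IsFirstOrder δ (fun v : ι ⊕ Unit → G => v (Sum.inr ()) ∈ Ψ (v ∘ Sum.inl))) :
    IsFirstOrder δ (fun v : ι ⊕ Unit → G =>
      v (Sum.inr ()) ∈ rightStabilizer (Ψ (v ∘ Sum.inl))) := by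
  have h1 : IsFirstOrder δ fun v : (ι ⊕ Unit) ⊕ Unit → G =>
      v (Sum.inr ()) * v (Sum.inl (Sum.inr ())) ∈ Ψ (v ∘ Sum.inl ∘ Sum.inl) :=
    hΨ.subst (Sum.elim (fun i => Term.var (Sum.inl (Sum.inl i)))
      fun _ => mulTerm (Term.var (Sum.inr ())) (Term.var (Sum.inl (Sum.inr ()))))
  have h2 : IsFirstOrder δ fun v : (ι ⊕ Unit) ⊕ Unit → G =>
      v (Sum.inr ()) ∈ Ψ (v ∘ Sum.inl ∘ Sum.inl) :=
    hΨ.relabel (Sum.elim (fun i => Sum.inl (Sum.inl i)) fun _ => Sum.inr ())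
  have h3 := (h1.iff h2).forall_tuple
  obtain ⟨θ, hθ⟩ := h3
  exact ⟨θ, fun v => (hθ v).trans ⟨fun h x => h fun _ => x, fun h w => h (w ())⟩⟩

/-- Congruence modulo the component is definable without parameters. -/
theorem IsComponent.isEmptyDefinable (hinv : IsLeftInvariantRel δ) {H : Subgroup G}
    (hH : IsComponent δ H) : IsEmptyDefinable δ {z : G × G | z.1⁻¹ * z.2 ∈ H} := by
  have := hH.1
  obtain ⟨ι, _, Ψ, hΨ, hΨ', c₀, hc₀⟩ := exists_family hH.2.1
  let e := Finite.equivFin (G ⧸ H)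
  have hstab := isFirstOrder_rightStabilizer hΨ
  -- First-order expression of the bound: the index of the right stabilizer of `Ψ c` is at most that
  -- of `H`.
  have hgood : IsFirstOrder δ fun c : ι → G => ∃ g : Fin (Nat.card (G ⧸ H)) → G,
      ∀ x : Unit → G, ∃ i, (g i)⁻¹ * x () ∈ rightStabilizer (Ψ c) := by
    have h1 : ∀ i, IsFirstOrder δ fun v : (ι ⊕ Fin (Nat.card (G ⧸ H))) ⊕ Unit → G =>
        (v (Sum.inl (Sum.inr i)))⁻¹ * v (Sum.inr ()) ∈
          rightStabilizer (Ψ (v ∘ Sum.inl ∘ Sum.inl)) := fun i =>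
      hstab.subst (Sum.elim (fun i => Term.var (Sum.inl (Sum.inl i)))
        fun _ => mulTerm (invTerm (Term.var (Sum.inl (Sum.inr i)))) (Term.var (Sum.inr ())))
    exact (IsFirstOrder.exists_finite h1).forall_tuple.exists_tuple
  have hmain : IsFirstOrder δ fun v : Fin 2 → G => ∀ c : ι → G,
      (∃ g : Fin (Nat.card (G ⧸ H)) → G,
        ∀ x : Unit → G, ∃ i, (g i)⁻¹ * x () ∈ rightStabilizer (Ψ c)) →
      (v 0)⁻¹ * v 1 ∈ rightStabilizer (Ψ c) := by
    have h1 : IsFirstOrder δ fun v : Fin 2 ⊕ ι → G =>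
        (v (Sum.inl 0))⁻¹ * v (Sum.inl 1) ∈ rightStabilizer (Ψ (v ∘ Sum.inr)) :=
      hstab.subst (Sum.elim (fun i => Term.var (Sum.inr i))
        fun _ => mulTerm (invTerm (Term.var (Sum.inl 0))) (Term.var (Sum.inl 1)))
    exact ((hgood.relabel Sum.inr).imp h1).forall_tuple
  -- `H` is the intersection of the right stabilizers of bounded index in the family: each contains
  -- `H` by minimality, and `H` occurs at `c₀`. Quantifying over all `c` removes the parameters.
  have hiff : ∀ y : G, y ∈ H ↔ ∀ c : ι → G, (∃ g : Fin (Nat.card (G ⧸ H)) → G,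
      ∀ x : Unit → G, ∃ i, (g i)⁻¹ * x () ∈ rightStabilizer (Ψ c)) →
      y ∈ rightStabilizer (Ψ c) := by
    intro y
    constructor
    · rintro hy c ⟨g, hg⟩
      have hfin : Finite (G ⧸ rightStabilizer (Ψ c)) := by
        refine Finite.of_surjective (fun i => ((g i : G) : G ⧸ rightStabilizer (Ψ c))) fun q => ?_
        obtain ⟨x, rfl⟩ := QuotientGroup.mk_surjective q
        obtain ⟨i, hi⟩ := hg fun _ => x
        exact ⟨i, QuotientGroup.eq.2 hi⟩
      have : (rightStabilizer (Ψ c)).FiniteIndex := Subgroup.finiteIndex_of_finite_quotient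
      exact hH.2.2 _ this (rightStabilizer_mem_defAlg hinv (hΨ' c)) hy
    · intro h
      have h1 := h c₀ ⟨fun i => (e.symm i).out, fun x => ⟨e (x () : G ⧸ H), ?_⟩⟩
      · rwa [hc₀, rightStabilizer_subgroup] at h1
      · rw [hc₀, rightStabilizer_subgroup, ← QuotientGroup.eq]
        simp
  let _ := deltaStructure δ
  obtain ⟨θ, hθ⟩ := hmain
  refine (Set.empty_definable_iff (L := deltaLanguage n)).2 ⟨θ, ?_⟩
  ext v
  exact (hiff _).trans (hθ v).symm

end Definability

/-! ### Existence and uniqueness of the relation -/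

section EDelta

variable {G : Type*} [Group G] {n : ℕ} {δ : G → (Fin n → G) → Prop} {H : Subgroup G}

theorem classes_leftRel (H : Subgroup G) :
    (QuotientGroup.leftRel H).classes = Set.range fun g : G => g • (H : Set G) := by
  have : ∀ g : G, {x | QuotientGroup.leftRel H x g} = g • (H : Set G) := by
    intro g
    ext x
    rw [mem_smul_subgroup, ← QuotientGroup.leftRel_apply]
    exact ⟨fun h => (QuotientGroup.leftRel H).symm h, fun h => (QuotientGroup.leftRel H).symm h⟩
  ext C
  exact exists_congr fun g => by rw [this, eq_comm]

theorem IsComponent.isEDelta (hH : IsComponent δ H) (hδ : DoubleLimit δ)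
    (hinv : IsLeftInvariantRel δ) : IsEDelta δ (QuotientGroup.leftRel H) := by
  have := hH.1
  refine ⟨⟨?_, ?_, ?_⟩, fun a b g => ?_, fun p q hp hq => ⟨?_, ?_⟩⟩
  · simpa only [QuotientGroup.leftRel_apply] using hH.isEmptyDefinable hinv
  · have : Finite (Quotient (QuotientGroup.leftRel H)) := inferInstanceAs (Finite (G ⧸ H))
    exact Finite.of_equiv _ (Setoid.quotientEquivClasses _)
  · rw [classes_leftRel]
    rintro _ ⟨g, rfl⟩
    exact smul_mem_defAlg hinv g hH.2.1
  · simp [QuotientGroup.leftRel_apply, mul_assoc]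
  · rintro rfl
    obtain ⟨W, rfl⟩ := hp.1.exists_ultrafilter
    obtain ⟨g, hg⟩ := (isGeneric_subgroup H).exists_eventually W
    refine ⟨g⁻¹ • (H : Set G), classes_leftRel H ▸ ⟨g⁻¹, rfl⟩, ?_⟩
    rw [and_self_iff]
    refine ⟨smul_mem_defAlg hinv _ hH.2.1, ?_⟩
    filter_upwards [hg] with x hx
    simpa [mem_smul_subgroup] using hx
  · rintro ⟨C, hC, hCp, hCq⟩
    rw [classes_leftRel] at hC
    obtain ⟨g, rfl⟩ := hC
    exact hH.genericType_eq hδ hinv hp hq hCp hCq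

/-- The class `K` of the identity is a definable subgroup of finite index, so `H ≤ K`. If `K`
contained a second coset of `H`, the distinct generic types of the two cosets would share the class
`K`. -/
theorem IsComponent.eq_leftRel (hH : IsComponent δ H) (hδ : DoubleLimit δ)
    (hinv : IsLeftInvariantRel δ) {E : Setoid G} (hE : IsEDelta δ E) :
    E = QuotientGroup.leftRel H := by
  obtain ⟨⟨-, hfin, hdef⟩, hEinv, htypes⟩ := hE
  let K : Subgroup G :=
    { carrier := {x | E 1 x}
      one_mem' := E.refl 1
      mul_mem' := by
        intro x y hx hy
        have h1 := (hEinv 1 y x).1 hy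
        rw [mul_one] at h1
        exact E.trans hx h1
      inv_mem' := by
        intro x hx
        have h1 := (hEinv 1 x x⁻¹).1 hx
        rw [mul_one, inv_mul_cancel] at h1
        exact E.symm h1 }
  have hEK : E = QuotientGroup.leftRel K := by
    ext a b
    rw [QuotientGroup.leftRel_apply, hEinv a b a⁻¹, inv_mul_cancel]
    rfl
  have hK : (K : Set G) ∈ E.classes := by
    rw [hEK, classes_leftRel]
    exact ⟨1, one_smul _ _⟩
  have hKfin : K.FiniteIndex := by
    have : Finite (G ⧸ K) := by
      rw [hEK] at hfin
      have := hfin.to_subtype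
      exact Finite.of_equiv _ (Setoid.quotientEquivClasses (QuotientGroup.leftRel K)).symm
    exact Subgroup.finiteIndex_of_finite_quotient
  have hle : H ≤ K := hH.2.2 K hKfin (hdef _ hK)
  have hle' : K ≤ H := by
    intro x hx
    obtain ⟨p, ⟨hp, hHp⟩, -⟩ := hH.existsUnique_genericType hδ hinv 1
    obtain ⟨q, ⟨hq, hHq⟩, -⟩ := hH.existsUnique_genericType hδ hinv x
    have hKmem : ∀ r, IsGenericType δ r → ∀ g ∈ K, g • (H : Set G) ∈ r → (K : Set G) ∈ r := by
      intro r hr g hg hgr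
      obtain ⟨W, rfl⟩ := hr.1.exists_ultrafilter
      refine ⟨hdef _ hK, mem_of_superset hgr.2 fun y hy => ?_⟩
      simpa using K.mul_mem hg (hle (mem_smul_subgroup.1 hy))
    have hpq : p = q := (htypes p q hp hq).2
      ⟨K, hK, hKmem p hp 1 K.one_mem hHp, hKmem q hq x hx hHq⟩
    subst hpq
    obtain ⟨W, rfl⟩ := hp.1.exists_ultrafilter
    obtain ⟨y, hy, hy'⟩ := W.neBot.nonempty_of_mem (inter_mem hHp.2 hHq.2)
    rw [mem_smul_subgroup] at hy hy'
    have h1 := H.mul_mem hy (H.inv_mem hy')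
    simpa using h1
  rw [hEK, le_antisymm hle' hle]

end EDelta

end LocalStable

open LocalStable in
theorem theorem2p3 {G : Type*} [Group G] {n : ℕ} (δ : G → (Fin n → G) → Prop)
    (hstable : IsStable δ) (hinv : IsLeftInvariantRel δ) :
    -- the relation `E_δ` exists and is unique, so that `G⁰_δ` is well defined
    (∃! E : Setoid G, IsEDelta δ E) ∧
    ∀ E : Setoid G, IsEDelta δ E →
      ∃ G0 : Subgroup G, (G0 : Set G) = identityClass E ∧
        -- (i)
        (G0.FiniteIndex ∧ (G0 : Set G) ∈ DefAlg δ ∧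
          E.classes = Set.range fun g : G => g • (G0 : Set G)) ∧
        -- (ii)
        (∀ g : G, ∃! p : Set (Set G), IsGenericType δ p ∧ g • (G0 : Set G) ∈ p) ∧
        -- (iii)
        (∀ φ ∈ DefAlg δ, ∀ g : G,
          Xor (IsGeneric ((g • (G0 : Set G)) ∩ φ)) (IsGeneric ((g • (G0 : Set G)) \ φ))) ∧
        -- (iv)
        (∀ φ ∈ DefAlg δ, ¬ IsGeneric (symmDiff φ
          (⋃₀ {C : Set G | (∃ g : G, C = g • (G0 : Set G)) ∧ IsGeneric (C ∩ φ)}))) ∧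
        -- (v)
        (∀ H : Subgroup G, H.FiniteIndex → (H : Set G) ∈ DefAlg δ → G0 ≤ H) ∧
        -- (vi)
        (∃! μ : DefAlg δ → ℝ, IsKeislerMeasure δ μ ∧ IsLeftInvariantMeasure δ μ) ∧
        (∀ μ : DefAlg δ → ℝ, IsKeislerMeasure δ μ → IsLeftInvariantMeasure δ μ →
          ∀ φ : DefAlg δ, 0 < μ φ ↔ IsGeneric (φ : Set G)) := by
  have hδ := hstable.doubleLimit
  obtain ⟨H, hH⟩ := exists_isComponent hδ hinv
  refine ⟨⟨_, hH.isEDelta hδ hinv, fun E hE => hH.eq_leftRel hδ hinv hE⟩, fun E hE => ?_⟩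
  obtain rfl := hH.eq_leftRel hδ hinv hE
  refine ⟨H, ?_, ⟨hH.1, hH.2.1, classes_leftRel H⟩, hH.existsUnique_genericType hδ hinv,
    fun φ hφ g => hH.xor_isGeneric hδ hinv hφ g, fun φ hφ => hH.not_isGeneric_symmDiff hδ hinv hφ,
    hH.2.2, existsUnique_keislerMeasure hδ hinv,
    fun μ hμ hμ' φ => keislerMeasure_pos_iff hδ hinv hμ hμ' φ⟩
  ext x
  change x ∈ H ↔ QuotientGroup.leftRel H x 1
  rw [QuotientGroup.leftRel_apply, mul_one, inv_mem_iff]
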